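/- Let $q:\mathbb R\to\mathbb C$ be $1$-periodic and Lebesgue integrable on $[0,1]$. Let $H$ be the Hill operator generated by $-y''+qy$ in $L_2(\mathbb R)$ (domain: all $y\in L_2(\mathbb R)$ with $y,y'$ locally absolutely continuous and $-y''+qy\in L_2(\mathbb R)$). For $t\in\mathbb R$ let $H_t$ be the operator generated in $L_2(0,1)$ by $-y''+qy$ and the boundary conditions $y(1)=e^{it}y(0)$, $y'(1)=e^{it}y'(0)$. Call an eigenvalue of $H_t$ simple if its algebraic multiplicity (the dimension of its root subspace $\bigcup_n\ker(H_t-\lambda)^n$) is $1$, and multiple if it is at least $2$. A point $\lambda_0\in\sigma(H)$ is a *spectral singularity* of $H$ if for every $\varepsilon>0$ the spectral projections $$-\frac1{2\pi i}\oint_{|z-\lambda|=r}(H_t-z)^{-1}\,dz$$ of the operators $H_t$, $t\in[0,2\pi)$, for the simple eigenvalues $\lambda$ of $H_t$ with $|\lambda-\lambda_0|<\varepsilon$ ($r>0$ so small that $\lambda$ is the only point of $\sigma(H_t)$ in $|z-\lambda|\le r$) are not uniformly bounded in norm. For $s\in\mathbb R$ and $\delta>0$ put $D(s,\delta)=(s-\delta,s)\cup(s,s+\delta)$.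 A point $\lambda_0\in\sigma(H)$ is an *essential spectral singularity* of $H$ if there are $s\in(-\pi,\pi]$ with $\lambda_0\in\sigma(H_s)$, a number $\delta>0$ and a continuous function $t\mapsto\lambda(t)$ on $D(s,\delta)$ such that $\lambda(t)$ is a simple eigenvalue of $H_t$ for every $t\in D(s,\delta)$, $\lambda(t)\to\lambda_0$ as $t\to s$, and $$\int_{D(s,\eta)}\frac{dt}{|\alpha(t)|}=\infty\quad\text{for all }\eta\in(0,\delta],\qquad \alpha(t)=(\Psi_t^*,\Psi_t),$$ where $\Psi_t$ and $\Psi_t^*$ are normalized eigenfunctions of $H_t$ and of its adjoint $H_t^*$ for the eigenvalues $\lambda(t)$ and $\overline{\lambda(t)}$ (so $|\alpha(t)|$ does not depend on their choice). **Theorem.** Let $t_0\in\mathbb R$ be not an integer multiple of $\pi$ (for $t_0\in(-\pi,\pi]$: $t_0\ne0,\pi$), and let $\lambda_0$ be a multiple eigenvalue of $H_{t_0}$. Then $\lambda_0$ is a spectral singularity of $H$, but not an essential spectral singularity of $H$. -/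

import Mathlib

open MeasureTheory Set Filter Topology

/-! ### Spectral theory of (unbounded) linear operators -/

namespace UnboundedOp

variable {E : Type*} [NormedAddCommGroup E] [NormedSpace ℂ E]

/-- `R` is the bounded resolvent `(T - z)⁻¹` of the unbounded operator `T`. -/
def IsResolvent (T : E →ₗ.[ℂ] E) (z : ℂ) (R : E →L[ℂ] E) : Prop :=
  (∀ f : E, ∃ h : R f ∈ T.domain, T ⟨R f, h⟩ - z • R f = f) ∧
    ∀ y : T.domain, R (T y - z • (y : E)) = y

/-- The resolvent set of an unbounded operator. -/
def resolventSet (T : E →ₗ.[ℂ] E) : Set ℂ := {z | ∃ R : E →L[ℂ] E, IsResolvent T z R}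

/-- The spectrum of an unbounded operator. -/
def spectrum (T : E →ₗ.[ℂ] E) : Set ℂ := (resolventSet T)ᶜ

/-- `ker (T - z)ⁿ`, on the natural domain of `(T - z)ⁿ`. -/
def kerPow (T : E →ₗ.[ℂ] E) (z : ℂ) : ℕ → Submodule ℂ E
  | 0 => ⊥
  | n + 1 => ((kerPow T z n).comap (T.toFun - z • T.domain.subtype)).map T.domain.subtype

/-- The root subspace `⋃ₙ ker (T - z)ⁿ`, spanned by eigenvectors and associated vectors. -/
def rootSpace (T : E →ₗ.[ℂ] E) (z : ℂ) : Submodule ℂ E := ⨆ n, kerPow T z n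

/-- The algebraic multiplicity of `z` as an eigenvalue of `T` (`0` if `z` is no eigenvalue). -/
noncomputable def algMult (T : E →ₗ.[ℂ] E) (z : ℂ) : ℕ∞ :=
  Cardinal.toENat (Module.rank ℂ (rootSpace T z))

/-- `z` is a simple eigenvalue of `T`. -/
def IsSimpleEigenvalue (T : E →ₗ.[ℂ] E) (z : ℂ) : Prop := algMult T z = 1

/-- `z` is a multiple eigenvalue of `T`. -/
def IsMultipleEigenvalue (T : E →ₗ.[ℂ] E) (z : ℂ) : Prop := 2 ≤ algMult T z

/-- `v` is a normalized eigenvector of `T` for the eigenvalue `z`. -/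
def IsNormalizedEigenvector (T : E →ₗ.[ℂ] E) (z : ℂ) (v : E) : Prop :=
  ‖v‖ = 1 ∧ ∃ h : v ∈ T.domain, T ⟨v, h⟩ = z • v

/-- `P` is the spectral projection `-(2πi)⁻¹ ∮ (T - z)⁻¹ dz` of `T` for the isolated point `w`,
the contour being a circle about `w` that encloses no other point of the spectrum. -/
def IsSpectralProjection (T : E →ₗ.[ℂ] E) (w : ℂ) (P : E →L[ℂ] E) : Prop :=
  ∃ r : ℝ, 0 < r ∧ Metric.closedBall w r ∩ spectrum T ⊆ {w} ∧
    ∃ R : ℂ → E →L[ℂ] E, (∀ z ∈ Metric.sphere w r, IsResolvent T z (R z)) ∧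
      P = -(2 * (Real.pi : ℂ) * Complex.I)⁻¹ • ∮ z in C(w, r), R z

end UnboundedOp

/-! ### The Hill operator and its quasiperiodic fibres -/

namespace Hill

/-- `f` and its derivative `f₁` are absolutely continuous on `[a, b]`, and `f₂` is the (almost
everywhere defined, integrable) second derivative of `f`. -/
structure TwiceAC (a b : ℝ) (f f₁ f₂ : ℝ → ℂ) : Prop where
  integrable : IntervalIntegrable f₂ volume a b
  deriv_eq : ∀ x ∈ Icc a b, f₁ x = f₁ a + ∫ s in a..x, f₂ s
  eq : ∀ x ∈ Icc a b, f x = f a + ∫ s in a..x, f₁ s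

theorem TwiceAC.deriv_integrable {a b : ℝ} {f f₁ f₂ : ℝ → ℂ} (hab : a ≤ b)
    (h : TwiceAC a b f f₁ f₂) : IntervalIntegrable f₁ volume a b := by
  apply ContinuousOn.intervalIntegrable
  rw [uIcc_of_le hab]
  have h1 : ContinuousOn (fun x => f₁ a + ∫ s in a..x, f₂ s) (Icc a b) := by
    have := intervalIntegral.continuousOn_primitive_interval'
      (h.integrable) (left_mem_uIcc)
    rw [uIcc_of_le hab] at this
    exact continuousOn_const.add this
  exact h1.congr h.deriv_eq

theorem TwiceAC.add {a b : ℝ} {f f₁ f₂ g g₁ g₂ : ℝ → ℂ} (hab : a ≤ b)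
    (hf : TwiceAC a b f f₁ f₂) (hg : TwiceAC a b g g₁ g₂) :
    TwiceAC a b (f + g) (f₁ + g₁) (f₂ + g₂) := by
  have sub : ∀ x ∈ Icc a b, uIcc a x ⊆ uIcc a b := fun x hx => by
    rw [uIcc_of_le hab, uIcc_of_le hx.1]; exact Icc_subset_Icc_right hx.2
  refine ⟨hf.integrable.add hg.integrable, fun x hx => ?_, fun x hx => ?_⟩
  · have := intervalIntegral.integral_add (hf.integrable.mono_set (sub x hx))
      (hg.integrable.mono_set (sub x hx))
    simp only [Pi.add_apply]
    rw [this, hf.deriv_eq x hx, hg.deriv_eq x hx]; ring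
  · have := intervalIntegral.integral_add ((hf.deriv_integrable hab).mono_set (sub x hx))
      ((hg.deriv_integrable hab).mono_set (sub x hx))
    simp only [Pi.add_apply]
    rw [this, hf.eq x hx, hg.eq x hx]; ring

theorem TwiceAC.smul {a b : ℝ} {f f₁ f₂ : ℝ → ℂ} (c : ℂ)
    (hf : TwiceAC a b f f₁ f₂) : TwiceAC a b (c • f) (c • f₁) (c • f₂) := by
  refine ⟨hf.integrable.smul c, fun x hx => ?_, fun x hx => ?_⟩
  · simp only [Pi.smul_apply, intervalIntegral.integral_smul]
    rw [hf.deriv_eq x hx, smul_add]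
  · simp only [Pi.smul_apply, intervalIntegral.integral_smul]
    rw [hf.eq x hx, smul_add]

theorem TwiceAC.zero (a b : ℝ) : TwiceAC a b 0 0 0 :=
  ⟨intervalIntegrable_const (c := (0 : ℂ)), by simp, by simp⟩

theorem ae_zero_of_primitive {a b : ℝ} (hab : a ≤ b) {u : ℝ → ℂ} {c : ℂ}
    (hu : IntervalIntegrable u volume a b)
    (h : ∀ᵐ x ∂volume.restrict (Ioc a b), c + ∫ s in a..x, u s = 0) :
    ∀ᵐ x ∂volume.restrict (Ioc a b), u x = 0 := by
  rcases hab.eq_or_lt with rfl | hlt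
  · simp
  have hc : ContinuousOn (fun x => c + ∫ s in a..x, u s) (Icc a b) := by
    have := intervalIntegral.continuousOn_primitive_interval' hu left_mem_uIcc
    rw [uIcc_of_le hab] at this
    exact continuousOn_const.add this
  have h0 : EqOn (fun x => c + ∫ s in a..x, u s) (fun _ => 0) (Icc a b) := by
    refine Measure.eqOn_Icc_of_ae_eq volume hlt.ne ?_ hc continuousOn_const
    rw [← restrict_Ioc_eq_restrict_Icc]
    exact h
  have hd := hu.ae_hasDerivAt_integral
  rw [ae_restrict_iff' measurableSet_Ioc]
  have hb : ∀ᵐ x : ℝ, x ≠ b := by simp [ae_iff, measure_singleton]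
  filter_upwards [hd, hb] with x hx hxb hxm
  have hxI : x ∈ Ioo a b := ⟨hxm.1, lt_of_le_of_ne hxm.2 hxb⟩
  have h1 := hx (by rw [uIcc_of_le hab]; exact Ioo_subset_Icc_self hxI) a left_mem_uIcc
  have h2 : HasDerivAt (fun x => ∫ s in a..x, u s) 0 x := by
    refine (hasDerivAt_const x (-c)).congr_of_eventuallyEq ?_
    filter_upwards [Ioo_mem_nhds hxI.1 hxI.2] with y hy
    exact eq_neg_of_add_eq_zero_right (h0 (Ioo_subset_Icc_self hy))
  exact h1.unique h2

theorem TwiceAC.ae_zero {a b : ℝ} (hab : a ≤ b) {f f₁ f₂ : ℝ → ℂ} (h : TwiceAC a b f f₁ f₂)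
    (h0 : ∀ᵐ x ∂volume.restrict (Ioc a b), f x = 0) :
    ∀ᵐ x ∂volume.restrict (Ioc a b), f₂ x = 0 := by
  have h1 : ∀ᵐ x ∂volume.restrict (Ioc a b), f₁ x = 0 := by
    refine ae_zero_of_primitive hab (c := f a) (h.deriv_integrable hab) ?_
    filter_upwards [h0, ae_restrict_mem measurableSet_Ioc] with x hx hm
    rw [← h.eq x (Ioc_subset_Icc_self hm), hx]
  refine ae_zero_of_primitive hab (c := f₁ a) h.integrable ?_
  filter_upwards [h1, ae_restrict_mem measurableSet_Ioc] with x hx hm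
  rw [← h.deriv_eq x (Ioc_subset_Icc_self hm), hx]

/-- The Hilbert space `L²(0, 1)`. -/
abbrev L2Unit : Type := Lp ℂ 2 (volume.restrict (Ioc (0 : ℝ) 1))

/-- The Hilbert space `L²(ℝ)`. -/
abbrev L2Line : Type := Lp ℂ 2 (volume : Measure ℝ)

/-- The graph of the operator `H_t`: the pairs `(y, -y'' + q y)` in `L²(0, 1)` with `y`, `y'`
absolutely continuous on `[0, 1]`, `y(1) = e^{it} y(0)` and `y'(1) = e^{it} y'(0)`. -/
def fibreGraph (q : ℝ → ℂ) (t : ℝ) : Submodule ℂ (L2Unit × L2Unit) where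
  carrier := {p | ∃ f f₁ f₂ : ℝ → ℂ, TwiceAC 0 1 f f₁ f₂ ∧
    f 1 = Complex.exp (Complex.I * t) * f 0 ∧
    f₁ 1 = Complex.exp (Complex.I * t) * f₁ 0 ∧
    (∀ᵐ x ∂volume.restrict (Ioc (0 : ℝ) 1), p.1 x = f x) ∧
    ∀ᵐ x ∂volume.restrict (Ioc (0 : ℝ) 1), p.2 x = -f₂ x + q x * f x}
  zero_mem' := by
    refine ⟨0, 0, 0, TwiceAC.zero 0 1, by simp, by simp, ?_, ?_⟩
    · filter_upwards [Lp.coeFn_zero ℂ 2 (volume.restrict (Ioc (0 : ℝ) 1))] with x hx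
      simpa using hx
    · filter_upwards [Lp.coeFn_zero ℂ 2 (volume.restrict (Ioc (0 : ℝ) 1))] with x hx
      simpa using hx
  add_mem' := by
    rintro p r ⟨f, f₁, f₂, hf, hf0, hf1, hp1, hp2⟩ ⟨g, g₁, g₂, hg, hg0, hg1, hr1, hr2⟩
    refine ⟨f + g, f₁ + g₁, f₂ + g₂, hf.add zero_le_one hg, ?_, ?_, ?_, ?_⟩
    · simp only [Pi.add_apply, hf0, hg0]; ring
    · simp only [Pi.add_apply, hf1, hg1]; ring
    · filter_upwards [Lp.coeFn_add p.1 r.1, hp1, hr1] with x hx h1 h2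
      simp only [Prod.fst_add, hx, Pi.add_apply, h1, h2]
    · filter_upwards [Lp.coeFn_add p.2 r.2, hp2, hr2] with x hx h1 h2
      simp only [Prod.snd_add, hx, Pi.add_apply, h1, h2]; ring
  smul_mem' := by
    rintro c p ⟨f, f₁, f₂, hf, hf0, hf1, hp1, hp2⟩
    refine ⟨c • f, c • f₁, c • f₂, hf.smul c, ?_, ?_, ?_, ?_⟩
    · simp only [Pi.smul_apply, smul_eq_mul, hf0]; ring
    · simp only [Pi.smul_apply, smul_eq_mul, hf1]; ring
    · filter_upwards [Lp.coeFn_smul c p.1, hp1] with x hx h1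
      simp only [Prod.smul_fst, hx, Pi.smul_apply, h1]
    · filter_upwards [Lp.coeFn_smul c p.2, hp2] with x hx h1
      simp only [Prod.smul_snd, hx, Pi.smul_apply, h1, smul_eq_mul]; ring

/-- The graph of the operator `H`: the pairs `(y, -y'' + q y)` in `L²(ℝ)` with `y`, `y'` locally
absolutely continuous. -/
def lineGraph (q : ℝ → ℂ) : Submodule ℂ (L2Line × L2Line) where
  carrier := {p | ∃ f f₁ f₂ : ℝ → ℂ, (∀ a b : ℝ, a ≤ b → TwiceAC a b f f₁ f₂) ∧
    (∀ᵐ x : ℝ, p.1 x = f x) ∧ ∀ᵐ x : ℝ, p.2 x = -f₂ x + q x * f x}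
  zero_mem' := by
    refine ⟨0, 0, 0, fun a b _ => TwiceAC.zero a b, ?_, ?_⟩
    · filter_upwards [Lp.coeFn_zero ℂ 2 (volume : Measure ℝ)] with x hx
      simpa using hx
    · filter_upwards [Lp.coeFn_zero ℂ 2 (volume : Measure ℝ)] with x hx
      simpa using hx
  add_mem' := by
    rintro p r ⟨f, f₁, f₂, hf, hp1, hp2⟩ ⟨g, g₁, g₂, hg, hr1, hr2⟩
    refine ⟨f + g, f₁ + g₁, f₂ + g₂, fun a b hab => (hf a b hab).add hab (hg a b hab), ?_, ?_⟩
    · filter_upwards [Lp.coeFn_add p.1 r.1, hp1, hr1] with x hx h1 h2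
      simp only [Prod.fst_add, hx, Pi.add_apply, h1, h2]
    · filter_upwards [Lp.coeFn_add p.2 r.2, hp2, hr2] with x hx h1 h2
      simp only [Prod.snd_add, hx, Pi.add_apply, h1, h2]; ring
  smul_mem' := by
    rintro c p ⟨f, f₁, f₂, hf, hp1, hp2⟩
    refine ⟨c • f, c • f₁, c • f₂, fun a b hab => (hf a b hab).smul c, ?_, ?_⟩
    · filter_upwards [Lp.coeFn_smul c p.1, hp1] with x hx h1
      simp only [Prod.smul_fst, hx, Pi.smul_apply, h1]
    · filter_upwards [Lp.coeFn_smul c p.2, hp2] with x hx h1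
      simp only [Prod.smul_snd, hx, Pi.smul_apply, h1, smul_eq_mul]; ring

/-- The operator `H_t` in `L²(0, 1)`, generated by `-y'' + q y` and the boundary conditions
`y(1) = e^{it} y(0)`, `y'(1) = e^{it} y'(0)`. -/
noncomputable def fibreOp (q : ℝ → ℂ) (t : ℝ) : L2Unit →ₗ.[ℂ] L2Unit :=
  (fibreGraph q t).toLinearPMap

/-- The Hill operator `H` generated by `-y'' + q y` in `L²(ℝ)`. -/
noncomputable def lineOp (q : ℝ → ℂ) : L2Line →ₗ.[ℂ] L2Line :=
  (lineGraph q).toLinearPMap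

theorem fibreOp_graph (q : ℝ → ℂ) (t : ℝ) : (fibreOp q t).graph = fibreGraph q t := by
  refine Submodule.toLinearPMap_graph_eq _ ?_
  rintro ⟨y, z⟩ ⟨f, f₁, f₂, hf, -, -, h1, h2⟩ (rfl : y = 0)
  have h0 : ∀ᵐ x ∂volume.restrict (Ioc (0 : ℝ) 1), f x = 0 := by
    filter_upwards [h1, Lp.coeFn_zero ℂ 2 (volume.restrict (Ioc (0 : ℝ) 1))] with x hx hx0
    rw [← hx]; simpa using hx0
  apply Lp.ext
  filter_upwards [h2, h0, hf.ae_zero zero_le_one h0,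
    Lp.coeFn_zero ℂ 2 (volume.restrict (Ioc (0 : ℝ) 1))] with x hx hx0 hx2 hz
  rw [hz, hx, hx0, hx2]; simp

theorem lineOp_graph (q : ℝ → ℂ) : (lineOp q).graph = lineGraph q := by
  refine Submodule.toLinearPMap_graph_eq _ ?_
  rintro ⟨y, z⟩ ⟨f, f₁, f₂, hf, h1, h2⟩ (rfl : y = 0)
  have h0 : ∀ᵐ x : ℝ, f x = 0 := by
    filter_upwards [h1, Lp.coeFn_zero ℂ 2 (volume : Measure ℝ)] with x hx hx0
    rw [← hx]; simpa using hx0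
  have hn : ∀ᵐ x : ℝ, ∀ n : ℕ, x ∈ Ioc (-(n : ℝ)) n → f₂ x = 0 := by
    rw [ae_all_iff]
    intro n
    rw [← ae_restrict_iff' measurableSet_Ioc]
    have hnn : -(n : ℝ) ≤ n := by linarith [(Nat.cast_nonneg n : (0 : ℝ) ≤ n)]
    exact (hf _ _ hnn).ae_zero hnn (ae_restrict_of_ae h0)
  apply Lp.ext
  filter_upwards [h2, h0, hn, Lp.coeFn_zero ℂ 2 (volume : Measure ℝ)] with x hx hx0 hx2 hz
  obtain ⟨n, hn⟩ := exists_nat_gt |x|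
  rw [hz, hx, hx0, hx2 n ⟨(abs_lt.1 hn).1, (abs_lt.1 hn).2.le⟩]; simp

/-- `w` is a spectral singularity of `H`: it lies in the spectrum of `H` and, in every disc about
`w`, the spectral projections of the operators `H_t`, `t ∈ [0, 2π)`, for the simple eigenvalues in
that disc are not uniformly bounded. -/
def IsSpectralSingularity (q : ℝ → ℂ) (w : ℂ) : Prop :=
  w ∈ UnboundedOp.spectrum (lineOp q) ∧
    ∀ ε : ℝ, 0 < ε → ¬ ∃ C : ℝ, ∀ t ∈ Ico (0 : ℝ) (2 * Real.pi), ∀ z ∈ Metric.ball w ε,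
      UnboundedOp.IsSimpleEigenvalue (fibreOp q t) z →
        ∀ P : L2Unit →L[ℂ] L2Unit, UnboundedOp.IsSpectralProjection (fibreOp q t) z P → ‖P‖ ≤ C

/-- The punctured interval `(s - δ, s) ∪ (s, s + δ)`. -/
def puncturedNhd (s δ : ℝ) : Set ℝ := Ioo (s - δ) s ∪ Ioo s (s + δ)

/-- `ev` is a continuous branch, on the punctured `δ`-neighbourhood of `s`, of simple eigenvalues
`ev t` of `H_t`, with normalized eigenfunctions `Ψ t` of `H_t` and `Ψs t` of the adjoint of `H_t`
(for the eigenvalue conjugate to `ev t`). -/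
structure IsSimpleBranch (q : ℝ → ℂ) (s δ : ℝ) (ev : ℝ → ℂ) (Ψ Ψs : ℝ → L2Unit) : Prop where
  continuousOn : ContinuousOn ev (puncturedNhd s δ)
  simple : ∀ t ∈ puncturedNhd s δ, UnboundedOp.IsSimpleEigenvalue (fibreOp q t) (ev t)
  eigen : ∀ t ∈ puncturedNhd s δ, UnboundedOp.IsNormalizedEigenvector (fibreOp q t) (ev t) (Ψ t)
  adjoint_eigen : ∀ t ∈ puncturedNhd s δ, UnboundedOp.IsNormalizedEigenvector
    (fibreOp q t).adjoint (starRingEnd ℂ (ev t)) (Ψs t)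

/-- `w` is an essential spectral singularity of `H`: it lies in the spectrum of `H`, and for some
quasimomentum `s ∈ (-π, π]` with `w ∈ σ(H_s)` there is a branch of simple eigenvalues near `s`
that tends to `w` and for which `1 / |α|`, where `α(t) = (Ψs t, Ψ t)`, is not integrable on any
punctured neighbourhood of `s`. -/
def IsEssentialSpectralSingularity (q : ℝ → ℂ) (w : ℂ) : Prop :=
  w ∈ UnboundedOp.spectrum (lineOp q) ∧
    ∃ s ∈ Ioc (-Real.pi) Real.pi, w ∈ UnboundedOp.spectrum (fibreOp q s) ∧
      ∃ δ : ℝ, 0 < δ ∧ ∃ (ev : ℝ → ℂ) (Ψ Ψs : ℝ → L2Unit), IsSimpleBranch q s δ ev Ψ Ψs ∧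
        Tendsto ev (𝓝[≠] s) (𝓝 w) ∧
        ∀ η ∈ Ioc 0 δ, ∫⁻ t in puncturedNhd s η, ‖inner ℂ (Ψs t) (Ψ t)‖ₑ⁻¹ = ⊤

end Hill

/-!
Let `M(z)` be the monodromy matrix of `-y'' + q y = z y` over one period and `F = tr M` the
discriminant. Since `det M = 1`, we have `det (M(z) - e^{it}) = e^{it} (2 cos t - F(z))`, so the
spectrum of `H_t` is the zero set of the entire function `F - 2 cos t`, and a zero that is not a
critical point of `F` is a simple eigenvalue. A multiple eigenvalue `w` of `H_{t₀}` is therefore a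
critical point, and as `F` is not constant, `F - F(w) = ψ ^ k` near `w` with `k ≥ 2` and `ψ` a local
coordinate.

*Spectral singularity.* As `sin t₀ ≠ 0`, the value `2 cos t` moves off `2 cos t₀` with `t`, hence
for `t` near `t₀` there are two distinct simple eigenvalues of `H_t` near `w`, with eigenfunctions
`u`, `v` depending continuously on `(t, z)`, so that `u` and `v` have the same nonzero limit. The
spectral projection `P` of the first eigenvalue satisfies `P u = u` and `P v = 0`, whence
`‖u‖ ≤ ‖P‖ ‖u - v‖` and `‖P‖ → ∞`. That `w` belongs to the spectrum of `H` follows by cutting off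
the Bloch wave of `w`: the error stems from the two ends of the cut-off only, while the norm grows
with the distance between them.

*No essential singularity.* Applying `adj (M(λ) - e^{it})` to the end values of the response to a
source `h` gives a vector `ℓ(h) a`, where `a` are the initial values of the eigenfunction `Ψ` of
`H_t`, and `ℓ(h) = 0` implies that `h` is in the range of `H_t - λ`; so `ℓ` is proportional to
`(Ψ*, ·)`. Variation of constants yields `|ℓ(Ψ)| = |F'(λ)|` up to normalization, hence
`|F'(λ)| ≤ C |α|`. On a branch `λ(t)` near `w` the coordinate `ψ` gives
`|F'(λ(t))| ≥ c |F(λ(t)) - F(w)| ^ ((k - 1) / k) ≥ c' |t - s| ^ ((k - 1) / k)`, whose reciprocal is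
integrable.
-/

namespace Hill

/-! ### Primitives of integrable functions -/

/-- `u` is a primitive on `[a, b]` of the integrable function `U`; equivalently, `u` is absolutely
continuous on `[a, b]` with almost everywhere derivative `U`. -/
structure IsPrimitiveOn {F : Type*} [NormedAddCommGroup F] [NormedSpace ℝ F] (a b : ℝ)
    (u U : ℝ → F) : Prop where
  integrable : IntervalIntegrable U volume a b
  eq : ∀ x ∈ Icc a b, u x = u a + ∫ s in a..x, U s

namespace IsPrimitiveOn

variable {F G : Type*} [NormedAddCommGroup F] [NormedSpace ℝ F] [NormedAddCommGroup G]
  [NormedSpace ℝ G] {a b : ℝ} {u U v V : ℝ → F}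

theorem of_integral (hU : IntervalIntegrable U volume a b) (c : F) :
    IsPrimitiveOn a b (fun x => c + ∫ s in a..x, U s) U :=
  ⟨hU, fun x _ => by simp⟩

theorem intervalIntegrable (h : IsPrimitiveOn a b u U) {x y : ℝ} (hx : x ∈ Icc a b)
    (hy : y ∈ Icc a b) : IntervalIntegrable U volume x y :=
  h.integrable.mono_set (uIcc_subset_uIcc (Icc_subset_uIcc hx) (Icc_subset_uIcc hy))

theorem integral_eq_sub (h : IsPrimitiveOn a b u U) {x y : ℝ} (hx : x ∈ Icc a b)
    (hy : y ∈ Icc a b) : ∫ s in x..y, U s = u y - u x := by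
  have ha : a ∈ Icc a b := left_mem_Icc.2 (hx.1.trans hx.2)
  rw [h.eq x hx, h.eq y hy, add_sub_add_left_eq_sub, intervalIntegral.integral_interval_sub_left
    (h.intervalIntegrable ha hy) (h.intervalIntegrable ha hx)]

theorem mono {c d : ℝ} (h : IsPrimitiveOn a b u U) (hc : c ∈ Icc a b) (hd : d ∈ Icc a b) :
    IsPrimitiveOn c d u U :=
  ⟨h.intervalIntegrable hc hd, fun x hx => by
    rw [h.integral_eq_sub hc ⟨hc.1.trans hx.1, hx.2.trans hd.2⟩, add_sub_cancel]⟩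

theorem continuousOn (h : IsPrimitiveOn a b u U) : ContinuousOn u (Icc a b) :=
  (continuousOn_const.add ((intervalIntegral.continuousOn_primitive_interval' h.integrable
    left_mem_uIcc).mono Icc_subset_uIcc)).congr h.eq

theorem congr (h : IsPrimitiveOn a b u U) (hab : a ≤ b) (hu : ∀ x ∈ Icc a b, v x = u x)
    (hU : ∀ᵐ x ∂volume.restrict (Ioc a b), V x = U x) : IsPrimitiveOn a b v V := by
  have hU' : U =ᵐ[volume.restrict (Ioc a b)] V := hU.mono fun _ => Eq.symm
  refine ⟨h.integrable.congr_ae (by rwa [uIoc_of_le hab]), fun x hx => ?_⟩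
  rw [hu x hx, hu a (left_mem_Icc.2 hab), h.eq x hx]
  refine congrArg (u a + ·) (intervalIntegral.integral_congr_ae_restrict ?_)
  rw [uIoc_of_le hx.1]
  exact ae_restrict_of_ae_restrict_of_subset (Ioc_subset_Ioc_right hx.2) hU'

theorem add (hu : IsPrimitiveOn a b u U) (hv : IsPrimitiveOn a b v V) :
    IsPrimitiveOn a b (fun x => u x + v x) (fun x => U x + V x) := by
  refine ⟨hu.integrable.add hv.integrable, fun x hx => ?_⟩
  have ha : a ∈ Icc a b := left_mem_Icc.2 (hx.1.trans hx.2)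
  rw [intervalIntegral.integral_add (hu.intervalIntegrable ha hx) (hv.intervalIntegrable ha hx),
    hu.eq x hx, hv.eq x hx, add_add_add_comm]

theorem map [CompleteSpace F] [CompleteSpace G] (L : F →L[ℝ] G) (h : IsPrimitiveOn a b u U) :
    IsPrimitiveOn a b (fun x => L (u x)) (fun x => L (U x)) := by
  refine ⟨⟨L.integrable_comp h.integrable.1, L.integrable_comp h.integrable.2⟩, fun x hx => ?_⟩
  have ha : a ∈ Icc a b := left_mem_Icc.2 (hx.1.trans hx.2)
  rw [L.intervalIntegral_comp_comm (h.intervalIntegrable ha hx), h.eq x hx, map_add]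

theorem absolutelyContinuousOnInterval (hab : a ≤ b) (h : IsPrimitiveOn a b u U) :
    AbsolutelyContinuousOnInterval u a b := by
  have hN := h.integrable.norm.absolutelyContinuousOnInterval_intervalIntegral left_mem_uIcc
  unfold AbsolutelyContinuousOnInterval at hN ⊢
  refine squeeze_zero' (Eventually.of_forall fun _ => Finset.sum_nonneg fun _ _ => dist_nonneg)
    ?_ hN
  rw [eventually_inf_principal]
  filter_upwards with E hE
  refine Finset.sum_le_sum fun i hi => ?_
  obtain ⟨hx, hy⟩ := hE.1 i hi
  rw [uIcc_of_le hab] at hx hy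
  have ha : a ∈ Icc a b := left_mem_Icc.2 hab
  rw [dist_eq_norm, dist_eq_norm, ← h.integral_eq_sub hy hx,
    intervalIntegral.integral_interval_sub_left (h.intervalIntegrable ha hx).norm
      (h.intervalIntegrable ha hy).norm]
  exact intervalIntegral.norm_integral_le_abs_integral_norm

theorem ae_hasDerivAt [CompleteSpace F] (h : IsPrimitiveOn a b u U) :
    ∀ᵐ x, x ∈ Ioo a b → HasDerivAt u (U x) x := by
  filter_upwards [h.integrable.ae_hasDerivAt_integral] with x hx hxI
  have hd := (hx (Icc_subset_uIcc (Ioo_subset_Icc_self hxI)) a left_mem_uIcc).const_add (u a)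
  refine hd.congr_of_eventuallyEq ?_
  filter_upwards [Icc_mem_nhds hxI.1 hxI.2] with y hy using h.eq y hy

theorem of_ae_hasDerivAt [CompleteSpace F] (hab : a ≤ b)
    (hu : AbsolutelyContinuousOnInterval u a b) (hU : IntervalIntegrable U volume a b)
    (hd : ∀ᵐ x, x ∈ Ioo a b → HasDerivAt u (U x) x) : IsPrimitiveOn a b u U := by
  have hP := of_integral hU (0 : F)
  have hne : ∀ c : ℝ, ∀ᵐ x : ℝ, x ≠ c := fun c => by simp [ae_iff, measure_singleton]
  have hd0 : ∀ᵐ x, x ∈ uIcc a b → HasDerivAt (fun x => u x - (0 + ∫ s in a..x, U s)) 0 x := by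
    filter_upwards [hd, hP.ae_hasDerivAt, hne a, hne b] with x hx hPx hxa hxb hxI
    rw [uIcc_of_le hab] at hxI
    have hxI' : x ∈ Ioo a b := ⟨hxI.1.lt_of_ne' hxa, hxI.2.lt_of_ne hxb⟩
    simpa using (hx hxI').fun_sub (hPx hxI')
  obtain ⟨C, hC⟩ :=
    (hu.fun_sub (hP.absolutelyContinuousOnInterval hab)).const_of_ae_hasDerivAt_zero hd0
  refine ⟨hU, fun x hx => ?_⟩
  have hCx := hC x (Icc_subset_uIcc hx)
  have hCa := hC a left_mem_uIcc
  simp only [intervalIntegral.integral_same, zero_add, sub_zero] at hCx hCa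
  rw [hCa, ← hCx, sub_add_cancel]

end IsPrimitiveOn

section ProductRule

variable {𝕜 : Type*} [RCLike 𝕜] {a b : ℝ} {u U v V : ℝ → 𝕜}

theorem IsPrimitiveOn.mul (hab : a ≤ b) (hu : IsPrimitiveOn a b u U)
    (hv : IsPrimitiveOn a b v V) :
    IsPrimitiveOn a b (fun x => u x * v x) (fun x => U x * v x + u x * V x) := by
  have hcu : ContinuousOn u (uIcc a b) := by rw [uIcc_of_le hab]; exact hu.continuousOn
  have hcv : ContinuousOn v (uIcc a b) := by rw [uIcc_of_le hab]; exact hv.continuousOn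
  refine .of_ae_hasDerivAt hab
    ((hu.absolutelyContinuousOnInterval hab).fun_smul (hv.absolutelyContinuousOnInterval hab))
    ((hu.integrable.mul_continuousOn hcv).add (hv.integrable.continuousOn_mul hcu)) ?_
  filter_upwards [hu.ae_hasDerivAt, hv.ae_hasDerivAt] with x hux hvx hx
  exact (hux hx).fun_mul (hvx hx)

end ProductRule

theorem IsPrimitiveOn.const_mul {a b : ℝ} {u U : ℝ → ℂ} (c : ℂ) (hu : IsPrimitiveOn a b u U) :
    IsPrimitiveOn a b (fun x => c * u x) (fun x => c * U x) :=
  hu.map (ContinuousLinearMap.mul ℝ ℂ c)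

theorem IsPrimitiveOn.sub {a b : ℝ} {u U v V : ℝ → ℂ} (hu : IsPrimitiveOn a b u U)
    (hv : IsPrimitiveOn a b v V) :
    IsPrimitiveOn a b (fun x => u x - v x) (fun x => U x - V x) := by
  simpa [sub_eq_add_neg] using hu.add (hv.const_mul (-1))

theorem IsPrimitiveOn.conj {a b : ℝ} {u U : ℝ → ℂ} (hu : IsPrimitiveOn a b u U) :
    IsPrimitiveOn a b (fun x => starRingEnd ℂ (u x)) (fun x => starRingEnd ℂ (U x)) :=
  hu.map Complex.conjCLE.toContinuousLinearMap

theorem TwiceAC.isPrimitiveOn_deriv {a b : ℝ} {f f₁ f₂ : ℝ → ℂ} (h : TwiceAC a b f f₁ f₂) :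
    IsPrimitiveOn a b f₁ f₂ := ⟨h.integrable, h.deriv_eq⟩

theorem TwiceAC.isPrimitiveOn {a b : ℝ} {f f₁ f₂ : ℝ → ℂ} (hab : a ≤ b)
    (h : TwiceAC a b f f₁ f₂) : IsPrimitiveOn a b f f₁ := ⟨h.deriv_integrable hab, h.eq⟩

theorem IsPrimitiveOn.twiceAC {a b : ℝ} {f f₁ f₂ : ℝ → ℂ} (h : IsPrimitiveOn a b f f₁)
    (h₁ : IsPrimitiveOn a b f₁ f₂) : TwiceAC a b f f₁ f₂ := ⟨h₁.integrable, h₁.eq, h.eq⟩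

/-! ### Linear Volterra equations in a Banach space -/

section Volterra

variable {F : Type*} [NormedAddCommGroup F]

/-- The continuous extension to the real line, by the end values, of a continuous function on
`[0, 1]`. It is the form in which elements of `C[0, 1]` are integrated. -/
noncomputable def extend (Y : C(unitInterval, F)) : C(ℝ, F) :=
  ContinuousMap.IccExtend zero_le_one Y

theorem extend_of_mem (Y : C(unitInterval, F)) {x : ℝ} (hx : x ∈ unitInterval) :
    extend Y x = Y ⟨x, hx⟩ :=
  IccExtend_of_mem _ _ hx

theorem norm_extend_le (Y : C(unitInterval, F)) (x : ℝ) : ‖extend Y x‖ ≤ ‖Y‖ :=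
  Y.norm_coe_le_norm _

theorem intervalIntegrable_of_mem {u : ℝ → F} (hu : IntervalIntegrable u volume 0 1) {x : ℝ}
    (hx : x ∈ unitInterval) : IntervalIntegrable u volume 0 x :=
  hu.mono_set (uIcc_subset_uIcc left_mem_uIcc (Icc_subset_uIcc hx))

variable [NormedSpace ℝ F]

/-- The primitive `x ↦ ∫₀ˣ u` of an integrable function, as an element of `C[0, 1]`. -/
noncomputable def primitive (u : ℝ → F) (hu : IntervalIntegrable u volume 0 1) :
    C(unitInterval, F) where
  toFun x := ∫ s in (0 : ℝ)..x, u s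
  continuous_toFun := continuousOn_iff_continuous_domRestrict.1
    ((intervalIntegral.continuousOn_primitive_interval' hu left_mem_uIcc).mono Icc_subset_uIcc)

theorem primitive_apply {u : ℝ → F} (hu : IntervalIntegrable u volume 0 1) (x : unitInterval) :
    primitive u hu x = ∫ s in (0 : ℝ)..x, u s := rfl

theorem norm_primitive_le {u : ℝ → F} (hu : IntervalIntegrable u volume 0 1) :
    ‖primitive u hu‖ ≤ ∫ s in (0 : ℝ)..1, ‖u s‖ := by
  have hmono : ∀ x : unitInterval, ∫ s in (0 : ℝ)..x, ‖u s‖ ≤ ∫ s in (0 : ℝ)..1, ‖u s‖ :=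
    fun x => intervalIntegral.integral_mono_interval le_rfl x.2.1 x.2.2
      (ae_of_all _ fun _ => norm_nonneg _) hu.norm
  exact (ContinuousMap.norm_le _ (intervalIntegral.integral_nonneg zero_le_one fun _ _ =>
    norm_nonneg _)).2 fun x =>
      (intervalIntegral.norm_integral_le_integral_norm x.2.1).trans (hmono x)

variable {E : Type*} [NormedAddCommGroup E] [NormedSpace ℂ E]

theorem intervalIntegrable_apply_extend {A : ℝ → E →L[ℂ] E}
    (hA : IntervalIntegrable A volume 0 1) (Y : C(unitInterval, E)) :
    IntervalIntegrable (fun s => A s (extend Y s)) volume 0 1 := by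
  refine (hA.norm.mul_const ‖Y‖).mono_fun ?_ (ae_of_all _ fun s => ?_)
  · exact (ContinuousLinearMap.id ℂ (E →L[ℂ] E)).aestronglyMeasurable_comp₂
      hA.aestronglyMeasurable_restrict_uIoc (extend Y).continuous.aestronglyMeasurable
  · exact ((A s).le_opNorm_of_le (norm_extend_le Y s)).trans (le_abs_self _)

/-- The Volterra operator `Y ↦ (x ↦ ∫₀ˣ A(s) Y(s) ds)` on `C([0, 1], E)`. -/
noncomputable def volterra {A : ℝ → E →L[ℂ] E} (hA : IntervalIntegrable A volume 0 1) :
    C(unitInterval, E) →L[ℂ] C(unitInterval, E) :=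
  LinearMap.mkContinuous
    { toFun Y := primitive _ (intervalIntegrable_apply_extend hA Y)
      map_add' Y Z := by
        ext x
        rw [ContinuousMap.add_apply, primitive_apply, primitive_apply, primitive_apply,
          ← intervalIntegral.integral_add
            (intervalIntegrable_of_mem (intervalIntegrable_apply_extend hA Y) x.2)
            (intervalIntegrable_of_mem (intervalIntegrable_apply_extend hA Z) x.2)]
        simp only [← map_add]; rfl
      map_smul' c Y := by
        ext x
        rw [RingHom.id_apply, ContinuousMap.smul_apply, primitive_apply, primitive_apply,
          ← intervalIntegral.integral_smul]
        simp only [← map_smul]; rfl }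
    (∫ s in (0 : ℝ)..1, ‖A s‖) fun Y => by
      refine (norm_primitive_le (intervalIntegrable_apply_extend hA Y)).trans ?_
      rw [← intervalIntegral.integral_mul_const]
      exact intervalIntegral.integral_mono_on zero_le_one
        (intervalIntegrable_apply_extend hA Y).norm (hA.norm.mul_const _)
        fun s _ => (A s).le_opNorm_of_le (norm_extend_le Y s)

theorem volterra_apply {A : ℝ → E →L[ℂ] E} (hA : IntervalIntegrable A volume 0 1)
    (Y : C(unitInterval, E)) (x : unitInterval) :
    volterra hA Y x = ∫ s in (0 : ℝ)..x, A s (extend Y s) := rfl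

theorem IsPrimitiveOn.pow_succ_div_factorial {a b : ℝ} {u U : ℝ → ℝ} (hab : a ≤ b)
    (hu : IsPrimitiveOn a b u U) (n : ℕ) :
    IsPrimitiveOn a b (fun x => u x ^ (n + 1) / (n + 1).factorial)
      (fun x => U x * (u x ^ n / n.factorial)) := by
  induction n with
  | zero => simpa using hu
  | succ n ih =>
    have hmul := (ih.mul hab hu).map (ContinuousLinearMap.mul ℝ ℝ ((n : ℝ) + 2)⁻¹)
    have hn : (n : ℝ) + 1 ≠ 0 := by positivity
    have hn' : (n : ℝ) + 2 ≠ 0 := by positivity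
    have hn'' : (n.factorial : ℝ) ≠ 0 := by positivity
    refine hmul.congr hab (fun x _ => ?_) (ae_of_all _ fun x => ?_) <;>
    · simp only [ContinuousLinearMap.mul_apply', Nat.factorial_succ]
      push_cast
      field_simp
      ring

theorem norm_volterra_pow_apply_le {A : ℝ → E →L[ℂ] E} (hA : IntervalIntegrable A volume 0 1)
    (Y : C(unitInterval, E)) (n : ℕ) (x : unitInterval) :
    ‖(volterra hA ^ n) Y x‖ ≤ (∫ s in (0 : ℝ)..x, ‖A s‖) ^ n / n.factorial * ‖Y‖ := by
  induction n generalizing x with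
  | zero => simpa using Y.norm_coe_le_norm x
  | succ n ih =>
    have h0 : (0 : ℝ) ∈ Icc (0 : ℝ) 1 := left_mem_Icc.2 zero_le_one
    have hprim : IsPrimitiveOn 0 1 (fun x => ∫ s in (0 : ℝ)..x, ‖A s‖) (fun s => ‖A s‖) := by
      simpa using IsPrimitiveOn.of_integral hA.norm 0
    have hpow := hprim.pow_succ_div_factorial zero_le_one n
    rw [pow_succ', mul_apply_eq_comp, volterra_apply]
    calc ‖∫ s in (0 : ℝ)..x, A s (extend ((volterra hA ^ n) Y) s)‖
        ≤ ∫ s in (0 : ℝ)..x, ‖A s‖ * ((∫ r in (0 : ℝ)..s, ‖A r‖) ^ n / n.factorial) * ‖Y‖ := by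
          refine intervalIntegral.norm_integral_le_of_norm_le x.2.1 (ae_of_all _ fun s hs => ?_)
            ((hpow.intervalIntegrable h0 x.2).mul_const _)
          have hs' : s ∈ unitInterval := ⟨hs.1.le, hs.2.trans x.2.2⟩
          rw [extend_of_mem _ hs', mul_assoc]
          exact (A s).le_opNorm_of_le (ih ⟨s, hs'⟩)
      _ = (∫ s in (0 : ℝ)..x, ‖A s‖) ^ (n + 1) / (n + 1).factorial * ‖Y‖ := by
          rw [intervalIntegral.integral_mul_const, hpow.integral_eq_sub h0 x.2]
          simp

theorem isUnit_one_sub_of_norm_pow_lt_one {R : Type*} [NormedRing R] [HasSummableGeomSeries R]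
    {x : R} {n : ℕ} (h : ‖x ^ n‖ < 1) : IsUnit (1 - x) := by
  have hu : IsUnit ((1 - x) * ∑ i ∈ Finset.range n, x ^ i) := by
    rw [mul_neg_geom_sum]
    exact isUnit_one_sub_of_norm_lt_one (R := R) h
  exact ((Commute.isUnit_mul_iff (Commute.sum_right _ _ _ fun i _ =>
    ((Commute.one_left x).sub_left (Commute.refl x)).pow_right i)).1 hu).1

variable [CompleteSpace E]

theorem isUnit_one_sub_volterra {A : ℝ → E →L[ℂ] E} (hA : IntervalIntegrable A volume 0 1) :
    IsUnit (1 - volterra hA) := by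
  obtain ⟨n, hn⟩ := ((FloorSemiring.tendsto_pow_div_factorial_atTop
    (∫ s in (0 : ℝ)..1, ‖A s‖)).eventually (gt_mem_nhds zero_lt_one)).exists
  have h0 : ∀ x ∈ unitInterval, 0 ≤ ∫ s in (0 : ℝ)..x, ‖A s‖ := fun x hx =>
    intervalIntegral.integral_nonneg hx.1 fun _ _ => norm_nonneg _
  have h1 := h0 1 (right_mem_Icc.2 zero_le_one)
  refine isUnit_one_sub_of_norm_pow_lt_one
    (R := C(unitInterval, E) →L[ℂ] C(unitInterval, E)) (n := n) (lt_of_le_of_lt ?_ hn)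
  refine ContinuousLinearMap.opNorm_le_bound _ (by positivity) fun Y =>
    (ContinuousMap.norm_le _ (by positivity)).2 fun x =>
      (norm_volterra_pow_apply_le hA Y n x).trans ?_
  have hle : ∫ s in (0 : ℝ)..x, ‖A s‖ ≤ ∫ s in (0 : ℝ)..1, ‖A s‖ :=
    intervalIntegral.integral_mono_interval le_rfl x.2.1 x.2.2
      (ae_of_all _ fun _ => norm_nonneg _) hA.norm
  have hx := h0 x x.2
  gcongr

theorem eq_inverse_one_sub_volterra_iff {A : ℝ → E →L[ℂ] E}
    (hA : IntervalIntegrable A volume 0 1) (Y Y₀ : C(unitInterval, E)) :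
    Y = Ring.inverse (1 - volterra hA) Y₀ ↔ Y = Y₀ + volterra hA Y := by
  have hu := isUnit_one_sub_volterra hA
  have hl : ∀ Z, Ring.inverse (1 - volterra hA) ((1 - volterra hA) Z) = Z := fun Z =>
    congrArg (fun L : C(unitInterval, E) →L[ℂ] C(unitInterval, E) => L Z)
      (Ring.inverse_mul_cancel _ hu)
  have hr : ∀ Z, (1 - volterra hA) (Ring.inverse (1 - volterra hA) Z) = Z := fun Z =>
    congrArg (fun L : C(unitInterval, E) →L[ℂ] C(unitInterval, E) => L Z)
      (Ring.mul_inverse_cancel _ hu)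
  calc Y = Ring.inverse (1 - volterra hA) Y₀ ↔ (1 - volterra hA) Y = Y₀ :=
        ⟨fun h => by rw [h, hr], fun h => by rw [← h, hl]⟩
    _ ↔ Y = Y₀ + volterra hA Y := by
        rw [sub_apply, one_apply_eq_self, sub_eq_iff_eq_add]

end Volterra

section Resolvent

variable {X E F : Type*} [NormedAddCommGroup X] [NormedSpace ℂ X] [CompleteSpace X]
  [NormedAddCommGroup E] [NormedSpace ℂ E] [NormedAddCommGroup F] [NormedSpace ℂ F]

theorem hasDerivAt_comp_inverse_one_sub_comp {v n : X →L[ℂ] X} {z : ℂ}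
    (hu : IsUnit (1 - (v - z • n))) (L : X →L[ℂ] F) (M : E →L[ℂ] X) :
    HasDerivAt (fun z => (L.comp (Ring.inverse (1 - (v - z • n)))).comp M)
      (-(L.comp (Ring.inverse (1 - (v - z • n)) * n *
        Ring.inverse (1 - (v - z • n)))).comp M) z := by
  obtain ⟨u, hu⟩ := hu
  have hV : HasDerivAt (fun z : ℂ => 1 - (v - z • n)) n z := by
    simpa using (((hasDerivAt_id z).smul_const n).const_sub v).const_sub 1
  have hinv := hasFDerivAt_ringInverse (𝕜 := ℂ) u
  rw [hu] at hinv
  rw [← hu, Ring.inverse_unit]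
  simpa using ((hasDerivAt_const z L).clm_comp (hinv.comp_hasDerivAt z hV)).clm_comp
    (hasDerivAt_const z M)

end Resolvent

/-! ### The first-order system of the Hill equation -/

/-- The matrix unit `eᵢ eⱼᵀ`, as an operator on `ℂ²`. The spaces of initial values and of pairs
`(y, y')` are `Fin 2 → ℂ`. -/
noncomputable def matrixUnit (i j : Fin 2) : (Fin 2 → ℂ) →L[ℂ] (Fin 2 → ℂ) :=
  (ContinuousLinearMap.single ℂ (fun _ => ℂ) i).comp (ContinuousLinearMap.proj j)

theorem matrixUnit_apply (i j : Fin 2) (c : Fin 2 → ℂ) : matrixUnit i j c = Pi.single i (c j) := rfl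

/-- The coefficient matrix `!![0, 1; q - z, 0]` of the first-order system for `(y, y')` that is
equivalent to `-y'' + q y = z y`. -/
noncomputable def hillCoeff (q : ℝ → ℂ) (z : ℂ) (s : ℝ) : (Fin 2 → ℂ) →L[ℂ] (Fin 2 → ℂ) :=
  matrixUnit 0 1 + (q s - z) • matrixUnit 1 0

section Solver

variable {q : ℝ → ℂ} (hq : IntervalIntegrable q volume 0 1)

include hq in
theorem intervalIntegrable_hillCoeff (z : ℂ) : IntervalIntegrable (hillCoeff q z) volume 0 1 :=
  intervalIntegrable_const.add
    ⟨(hq.sub intervalIntegrable_const).1.smul_const _,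
      (hq.sub intervalIntegrable_const).2.smul_const _⟩

/-- The Volterra operator of the Hill equation: pairs `Y = (y, y')` that solve it are the solutions
of `Y = Y(0) + V Y`. -/
noncomputable def hillVolterra (z : ℂ) :
    C(unitInterval, Fin 2 → ℂ) →L[ℂ] C(unitInterval, Fin 2 → ℂ) :=
  volterra (intervalIntegrable_hillCoeff hq z)

/-- The operator `Y ↦ (0, ∫₀ˣ Y₀)`, the negative of the derivative of `hillVolterra` in the
spectral parameter. -/
noncomputable def spectralVolterra :
    C(unitInterval, Fin 2 → ℂ) →L[ℂ] C(unitInterval, Fin 2 → ℂ) :=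
  volterra (A := fun _ => matrixUnit 1 0) intervalIntegrable_const

theorem hillVolterra_eq_sub_smul (z : ℂ) :
    hillVolterra hq z = hillVolterra hq 0 - z • spectralVolterra := by
  ext1 Y
  ext1 x
  have h0 := intervalIntegrable_of_mem
    (intervalIntegrable_apply_extend (intervalIntegrable_hillCoeff hq 0) Y) x.2
  have h1 : IntervalIntegrable (fun s => z • matrixUnit 1 0 (extend Y s)) volume 0 x :=
    (intervalIntegrable_of_mem (intervalIntegrable_apply_extend intervalIntegrable_const Y)
      x.2).smul z
  simp only [hillVolterra, spectralVolterra, sub_apply, smul_apply, ContinuousMap.sub_apply,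
    ContinuousMap.smul_apply, volterra_apply]
  rw [← intervalIntegral.integral_smul, ← intervalIntegral.integral_sub h0 h1]
  refine intervalIntegral.integral_congr fun s _ => ?_
  simp only [hillCoeff, add_apply, smul_apply, sub_zero, sub_smul]
  abel

/-- The solution operator `Y₀ ↦ Y` of the equation `Y = Y₀ + V Y`, where `V = hillVolterra hq z`. -/
noncomputable def solver (z : ℂ) : C(unitInterval, Fin 2 → ℂ) →L[ℂ] C(unitInterval, Fin 2 → ℂ) :=
  Ring.inverse (1 - hillVolterra hq z)

theorem eq_solver_iff (z : ℂ) (Y Y₀ : C(unitInterval, Fin 2 → ℂ)) :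
    Y = solver hq z Y₀ ↔ Y = Y₀ + hillVolterra hq z Y :=
  eq_inverse_one_sub_volterra_iff (intervalIntegrable_hillCoeff hq z) Y Y₀

theorem hasDerivAt_comp_solver_comp {E F : Type*} [NormedAddCommGroup E] [NormedSpace ℂ E]
    [NormedAddCommGroup F] [NormedSpace ℂ F] (L : C(unitInterval, Fin 2 → ℂ) →L[ℂ] F)
    (M : E →L[ℂ] C(unitInterval, Fin 2 → ℂ)) (z : ℂ) :
    HasDerivAt (fun z => (L.comp (solver hq z)).comp M)
      (-(L.comp (solver hq z * spectralVolterra * solver hq z)).comp M) z := by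
  have hu : IsUnit (1 - hillVolterra hq z) :=
    isUnit_one_sub_volterra (intervalIntegrable_hillCoeff hq z)
  rw [hillVolterra_eq_sub_smul] at hu
  have hsolver : solver hq = fun z =>
      Ring.inverse (1 - (hillVolterra hq 0 - z • spectralVolterra)) :=
    funext fun z => by rw [solver, hillVolterra_eq_sub_smul]
  rw [hsolver]
  exact hasDerivAt_comp_inverse_one_sub_comp hu L M

end Solver

/-! ### The initial value problem with a source in `L²(0, 1)` -/

theorem memLp_extend (y : C(unitInterval, ℂ)) :
    MemLp (extend y) 2 (volume.restrict (Ioc (0 : ℝ) 1)) :=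
  MemLp.of_bound (extend y).continuous.aestronglyMeasurable ‖y‖ (ae_of_all _ (norm_extend_le y))

/-- The embedding `C[0, 1] → L²(0, 1)`. -/
noncomputable def toL2 : C(unitInterval, ℂ) →L[ℂ] L2Unit :=
  LinearMap.mkContinuous
    { toFun y := (memLp_extend y).toLp (extend y)
      map_add' y z := (memLp_extend y).toLp_add (memLp_extend z)
      map_smul' c y := (memLp_extend y).toLp_const_smul c }
    1 fun y => by
      have hbound : ∀ᵐ x ∂volume.restrict (Ioc (0 : ℝ) 1),
          ‖(memLp_extend y).toLp (extend y) x‖ ≤ ‖y‖ :=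
        (memLp_extend y).coeFn_toLp.mono fun x hx => hx ▸ norm_extend_le y x
      have hle := Lp.norm_le_of_ae_bound (norm_nonneg y) hbound
      have hvol : (measureUnivNNReal (volume.restrict (Ioc (0 : ℝ) 1)) : ℝ) = 1 := by
        simp [measureUnivNNReal]
      rwa [hvol, Real.one_rpow] at hle

theorem toL2_coeFn (y : C(unitInterval, ℂ)) :
    ∀ᵐ x ∂volume.restrict (Ioc (0 : ℝ) 1), toL2 y x = extend y x :=
  (memLp_extend y).coeFn_toLp

theorem integrable_coeFn (h : L2Unit) : Integrable h (volume.restrict (Ioc (0 : ℝ) 1)) :=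
  (Lp.memLp h).integrable one_le_two

theorem intervalIntegrable_coeFn (h : L2Unit) : IntervalIntegrable h volume 0 1 :=
  (intervalIntegrable_iff_integrableOn_Ioc_of_le zero_le_one).2 (integrable_coeFn h)

theorem integral_norm_coeFn_le (h : L2Unit) : ∫ s in (0 : ℝ)..1, ‖h s‖ ≤ ‖h‖ := by
  rw [intervalIntegral.integral_of_le zero_le_one, integral_norm_eq_lintegral_enorm
    (integrable_coeFn h).1, Lp.norm_def, ← eLpNorm_one_eq_lintegral_enorm]
  have : IsProbabilityMeasure (volume.restrict (Ioc (0 : ℝ) 1)) := ⟨by simp⟩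
  exact ENNReal.toReal_mono (Lp.eLpNorm_ne_top h)
    (eLpNorm_le_eLpNorm_of_exponent_le one_le_two (integrable_coeFn h).1)

theorem integral_congr_of_ae_unit {f g : ℝ → ℂ}
    (h : ∀ᵐ x ∂volume.restrict (Ioc (0 : ℝ) 1), f x = g x) {x : ℝ} (hx : x ∈ unitInterval) :
    ∫ s in (0 : ℝ)..x, f s = ∫ s in (0 : ℝ)..x, g s := by
  refine intervalIntegral.integral_congr_ae_restrict ?_
  rw [uIoc_of_le hx.1]
  exact ae_restrict_of_ae_restrict_of_subset (Ioc_subset_Ioc_right hx.2) h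

/-- The operator `h ↦ ∫₀ˣ h` from `L²(0, 1)` to `C[0, 1]`. -/
noncomputable def integL2 : L2Unit →L[ℂ] C(unitInterval, ℂ) :=
  LinearMap.mkContinuous
    { toFun h := primitive h (intervalIntegrable_coeFn h)
      map_add' f g := by
        ext x
        rw [ContinuousMap.add_apply, primitive_apply, primitive_apply, primitive_apply,
          ← intervalIntegral.integral_add
            (intervalIntegrable_of_mem (intervalIntegrable_coeFn f) x.2)
            (intervalIntegrable_of_mem (intervalIntegrable_coeFn g) x.2)]
        exact integral_congr_of_ae_unit (Lp.coeFn_add f g) x.2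
      map_smul' c f := by
        ext x
        rw [RingHom.id_apply, ContinuousMap.smul_apply, primitive_apply, primitive_apply,
          ← intervalIntegral.integral_smul]
        exact integral_congr_of_ae_unit (Lp.coeFn_smul c f) x.2 }
    1 fun h => by
      rw [one_mul]
      exact (norm_primitive_le (intervalIntegrable_coeFn h)).trans (integral_norm_coeFn_le h)

/-- The inhomogeneity `(0, -∫₀ˣ h)` of the integral equation for the pair `(y, y')` that belongs
to `-y'' + (q - z) y = h`. -/
noncomputable def source : L2Unit →L[ℂ] C(unitInterval, Fin 2 → ℂ) :=
  -((ContinuousLinearMap.single ℂ (fun _ : Fin 2 => ℂ) 1).compLeftContinuous ℂ unitInterval).comp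
    integL2

theorem source_apply (h : L2Unit) (x : unitInterval) :
    source h x = ![0, -∫ s in (0 : ℝ)..x, h s] := by
  have : source h x = -Pi.single 1 (∫ s in (0 : ℝ)..x, h s) := rfl
  ext i
  fin_cases i <;> simp [this]

/-- The component of index `i` of a continuous curve in `ℂ²`. -/
noncomputable def component (i : Fin 2) : C(unitInterval, Fin 2 → ℂ) →L[ℂ] C(unitInterval, ℂ) :=
  (ContinuousLinearMap.proj i).compLeftContinuous ℂ unitInterval

theorem extend_component (i : Fin 2) (Y : C(unitInterval, Fin 2 → ℂ)) (x : ℝ) :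
    extend (component i Y) x = extend Y x i := rfl

/-- The constant curves in `ℂ²`. -/
noncomputable def constCurve : (Fin 2 → ℂ) →L[ℂ] C(unitInterval, Fin 2 → ℂ) :=
  ContinuousLinearMap.const ℂ unitInterval

theorem constCurve_apply (c : Fin 2 → ℂ) (x : unitInterval) : constCurve c x = c := rfl

theorem spectralVolterra_apply (Y : C(unitInterval, Fin 2 → ℂ)) (x : unitInterval) :
    spectralVolterra Y x = ![0, ∫ s in (0 : ℝ)..x, extend Y s 0] := by
  have hint := intervalIntegrable_of_mem
    (intervalIntegrable_apply_extend (A := fun _ => matrixUnit 1 0) intervalIntegrable_const Y) x.2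
  ext i
  have hi := (ContinuousLinearMap.proj (R := ℂ) (φ := fun _ : Fin 2 => ℂ)
    i).intervalIntegral_comp_comm hint
  rw [ContinuousLinearMap.proj_apply] at hi
  rw [spectralVolterra, volterra_apply, ← hi]
  fin_cases i <;> simp [matrixUnit_apply]

section InitialValueProblem

variable {q : ℝ → ℂ} (hq : IntervalIntegrable q volume 0 1)

theorem hillVolterra_apply (z : ℂ) (Y : C(unitInterval, Fin 2 → ℂ)) (x : unitInterval) :
    hillVolterra hq z Y x =
      ![∫ s in (0 : ℝ)..x, extend Y s 1, ∫ s in (0 : ℝ)..x, (q s - z) * extend Y s 0] := by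
  have hint := intervalIntegrable_of_mem
    (intervalIntegrable_apply_extend (intervalIntegrable_hillCoeff hq z) Y) x.2
  ext i
  have hi := (ContinuousLinearMap.proj (R := ℂ) (φ := fun _ : Fin 2 => ℂ)
    i).intervalIntegral_comp_comm hint
  rw [ContinuousLinearMap.proj_apply] at hi
  rw [hillVolterra, volterra_apply, ← hi]
  fin_cases i <;> simp [hillCoeff, matrixUnit_apply]

include hq in
theorem intervalIntegrable_potential_mul (z : ℂ) (y : C(unitInterval, ℂ)) :
    IntervalIntegrable (fun s => (q s - z) * extend y s) volume 0 1 :=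
  (hq.sub intervalIntegrable_const).mul_continuousOn (extend y).continuous.continuousOn

/-- The solution `(y, y')` of `-y'' + (q - z) y = h` with `(y(0), y'(0)) = c`. -/
noncomputable def solPair (z : ℂ) (c : Fin 2 → ℂ) (h : L2Unit) : C(unitInterval, Fin 2 → ℂ) :=
  solver hq z (constCurve c + source h)

/-- The solution `y` of `-y'' + (q - z) y = h` with `(y(0), y'(0)) = c`. -/
noncomputable def sol (z : ℂ) (c : Fin 2 → ℂ) (h : L2Unit) : C(unitInterval, ℂ) :=
  component 0 (solPair hq z c h)

/-- The derivative of `sol hq z c h`. -/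
noncomputable def solDeriv (z : ℂ) (c : Fin 2 → ℂ) (h : L2Unit) : C(unitInterval, ℂ) :=
  component 1 (solPair hq z c h)

theorem eq_solPair_iff (z : ℂ) (c : Fin 2 → ℂ) (h : L2Unit) (Y : C(unitInterval, Fin 2 → ℂ)) :
    Y = solPair hq z c h ↔ ∀ x ∈ unitInterval,
      extend Y x 0 = c 0 + ∫ s in (0 : ℝ)..x, extend Y s 1 ∧
      extend Y x 1 = c 1 + ∫ s in (0 : ℝ)..x, ((q s - z) * extend Y s 0 - h s) := by
  have hsub : ∀ x ∈ unitInterval, ∫ s in (0 : ℝ)..x, ((q s - z) * extend Y s 0 - h s) =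
      (∫ s in (0 : ℝ)..x, (q s - z) * extend Y s 0) - ∫ s in (0 : ℝ)..x, h s := fun x hx =>
    intervalIntegral.integral_sub
      (intervalIntegrable_of_mem (intervalIntegrable_potential_mul hq z (component 0 Y)) hx)
      (intervalIntegrable_of_mem (intervalIntegrable_coeFn h) hx)
  rw [solPair, eq_solver_iff, ContinuousMap.ext_iff, Subtype.forall]
  refine forall₂_congr fun x hx => ?_
  rw [ContinuousMap.add_apply, ContinuousMap.add_apply, hillVolterra_apply,
    source_apply, constCurve_apply, hsub x hx, extend_of_mem Y hx, funext_iff, Fin.forall_fin_two]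
  simp only [Pi.add_apply, Matrix.cons_val_zero, Matrix.cons_val_one, add_zero]
  rw [add_assoc (c 1), neg_add_eq_sub]

theorem extend_sol_zero (z : ℂ) (c : Fin 2 → ℂ) (h : L2Unit) :
    extend (sol hq z c h) 0 = c 0 := by
  rw [sol, extend_component]
  simpa using ((eq_solPair_iff hq z c h _).1 rfl 0 (left_mem_Icc.2 zero_le_one)).1

theorem extend_solDeriv_zero (z : ℂ) (c : Fin 2 → ℂ) (h : L2Unit) :
    extend (solDeriv hq z c h) 0 = c 1 := by
  rw [solDeriv, extend_component]
  simpa using ((eq_solPair_iff hq z c h _).1 rfl 0 (left_mem_Icc.2 zero_le_one)).2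

theorem isPrimitiveOn_sol (z : ℂ) (c : Fin 2 → ℂ) (h : L2Unit) :
    IsPrimitiveOn 0 1 (extend (sol hq z c h)) (extend (solDeriv hq z c h)) where
  integrable := (extend (solDeriv hq z c h)).continuous.intervalIntegrable 0 1
  eq x hx := by
    rw [extend_sol_zero]
    exact ((eq_solPair_iff hq z c h _).1 rfl x hx).1

theorem isPrimitiveOn_solDeriv (z : ℂ) (c : Fin 2 → ℂ) (h : L2Unit) :
    IsPrimitiveOn 0 1 (extend (solDeriv hq z c h))
      (fun s => (q s - z) * extend (sol hq z c h) s - h s) where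
  integrable := (intervalIntegrable_potential_mul hq z _).sub (intervalIntegrable_coeFn h)
  eq x hx := by
    rw [extend_solDeriv_zero]
    exact ((eq_solPair_iff hq z c h _).1 rfl x hx).2

theorem TwiceAC.eqOn_sol {f f₁ f₂ : ℝ → ℂ} (hf : TwiceAC 0 1 f f₁ f₂) (z : ℂ) (h : L2Unit)
    (hf₂ : ∀ᵐ x ∂volume.restrict (Ioc (0 : ℝ) 1), f₂ x = (q x - z) * f x - h x) :
    EqOn f (extend (sol hq z ![f 0, f₁ 0] h)) unitInterval ∧
      EqOn f₁ (extend (solDeriv hq z ![f 0, f₁ 0] h)) unitInterval := by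
  have hcont : ContinuousOn (fun x => ![f x, f₁ x]) unitInterval := by
    refine continuousOn_pi.2 fun i => ?_
    fin_cases i
    exacts [(hf.isPrimitiveOn zero_le_one).continuousOn, hf.isPrimitiveOn_deriv.continuousOn]
  let Y : C(unitInterval, Fin 2 → ℂ) := ⟨_, continuousOn_iff_continuous_domRestrict.1 hcont⟩
  have hY : ∀ x ∈ unitInterval, extend Y x = ![f x, f₁ x] := fun x hx => extend_of_mem Y hx
  have heq : Y = solPair hq z ![f 0, f₁ 0] h := by
    refine (eq_solPair_iff hq z _ h Y).2 fun x hx => ⟨?_, ?_⟩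
    · rw [hY x hx, integral_congr_of_ae_unit (g := f₁) ?_ hx]
      · exact hf.eq x hx
      · filter_upwards [ae_restrict_mem measurableSet_Ioc] with s hs
        rw [hY s (Ioc_subset_Icc_self hs)]; rfl
    · rw [hY x hx, integral_congr_of_ae_unit (g := f₂) ?_ hx]
      · exact hf.deriv_eq x hx
      · filter_upwards [hf₂, ae_restrict_mem measurableSet_Ioc] with s hs hm
        rw [hs, hY s (Ioc_subset_Icc_self hm)]; rfl
  rw [sol, solDeriv, ← heq]
  refine ⟨fun x hx => ?_, fun x hx => ?_⟩ <;> rw [extend_component, hY x hx] <;> rfl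

/-- The right end value of a curve in `ℂ²`. -/
noncomputable def endpoint : C(unitInterval, Fin 2 → ℂ) →L[ℂ] (Fin 2 → ℂ) :=
  ContinuousMap.evalCLM ℂ 1

theorem endpoint_apply (Y : C(unitInterval, Fin 2 → ℂ)) : endpoint Y = extend Y 1 :=
  (extend_of_mem Y (right_mem_Icc.2 zero_le_one)).symm

theorem endpoint_solPair_eq_smul_iff (z μ : ℂ) (c : Fin 2 → ℂ) (h : L2Unit) :
    endpoint (solPair hq z c h) = μ • c ↔
      extend (sol hq z c h) 1 = μ * extend (sol hq z c h) 0 ∧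
        extend (solDeriv hq z c h) 1 = μ * extend (solDeriv hq z c h) 0 := by
  rw [extend_sol_zero, extend_solDeriv_zero, endpoint_apply, funext_iff, Fin.forall_fin_two]
  rfl

theorem mem_fibreGraph_iff_endpoint (t : ℝ) (z : ℂ) (y h : L2Unit) :
    (y, h + z • y) ∈ fibreGraph q t ↔ ∃ c : Fin 2 → ℂ, y = toL2 (sol hq z c h) ∧
      endpoint (solPair hq z c h) = Complex.exp (Complex.I * t) • c := by
  have hcoe : ∀ᵐ x ∂volume.restrict (Ioc (0 : ℝ) 1), (h + z • y) x = h x + z * y x := by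
    filter_upwards [Lp.coeFn_add h (z • y), Lp.coeFn_smul z y] with x h1 h2
    rw [h1, Pi.add_apply, h2]; rfl
  simp only [endpoint_solPair_eq_smul_iff]
  constructor
  · rintro ⟨f, f₁, f₂, hf, hf1, hf₁1, hy, hg⟩
    obtain ⟨hsol, hderiv⟩ := hf.eqOn_sol hq z h (by
      filter_upwards [hcoe, hy, hg] with x hcoex hyx hgx
      linear_combination hgx - hcoex - z * hyx)
    have h0 : (0 : ℝ) ∈ unitInterval := left_mem_Icc.2 zero_le_one
    have h1 : (1 : ℝ) ∈ unitInterval := right_mem_Icc.2 zero_le_one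
    refine ⟨![f 0, f₁ 0], Lp.ext ?_, ?_, ?_⟩
    · filter_upwards [hy, toL2_coeFn (sol hq z ![f 0, f₁ 0] h),
        ae_restrict_mem measurableSet_Ioc] with x hyx hx hm
      rw [hx, ← hsol (Ioc_subset_Icc_self hm)]
      exact hyx
    · rw [← hsol h1, ← hsol h0, hf1]
    · rw [← hderiv h1, ← hderiv h0, hf₁1]
  · rintro ⟨c, hy, hsol, hderiv⟩
    have hycoe : ∀ᵐ x ∂volume.restrict (Ioc (0 : ℝ) 1), y x = extend (sol hq z c h) x := by
      rw [hy]
      exact toL2_coeFn _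
    refine ⟨_, _, _, (isPrimitiveOn_sol hq z c h).twiceAC
      (isPrimitiveOn_solDeriv hq z c h), hsol, hderiv, hycoe, ?_⟩
    filter_upwards [hycoe, hcoe] with x hx hcoex
    rw [hcoex, ← hx]
    ring

theorem initial_eq_zero_of_toL2_sol_eq_zero {z : ℂ} {c : Fin 2 → ℂ}
    (h : toL2 (sol hq z c 0) = 0) : c = 0 := by
  have hsol : EqOn (extend (sol hq z c 0)) (fun _ => 0) (Icc 0 1) := by
    refine Measure.eqOn_Icc_of_ae_eq volume zero_ne_one ?_ (extend _).continuous.continuousOn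
      continuousOn_const
    rw [← restrict_Ioc_eq_restrict_Icc]
    filter_upwards [toL2_coeFn (sol hq z c 0),
      Lp.coeFn_zero ℂ 2 (volume.restrict (Ioc (0 : ℝ) 1))] with x h1 h2
    rw [← h1, h, h2]; rfl
  have hderiv : ∀ᵐ x ∂volume.restrict (Ioc (0 : ℝ) 1), extend (solDeriv hq z c 0) x = 0 := by
    refine ae_zero_of_primitive zero_le_one (c := c 0)
      (isPrimitiveOn_sol hq z c 0).integrable ?_
    filter_upwards [ae_restrict_mem measurableSet_Ioc] with x hx
    rw [← extend_sol_zero hq z c 0, ← (isPrimitiveOn_sol hq z c 0).eq x (Ioc_subset_Icc_self hx)]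
    exact hsol (Ioc_subset_Icc_self hx)
  have hderiv0 : EqOn (extend (solDeriv hq z c 0)) (fun _ => 0) (Icc 0 1) := by
    refine Measure.eqOn_Icc_of_ae_eq volume zero_ne_one ?_ (extend _).continuous.continuousOn
      continuousOn_const
    rwa [← restrict_Ioc_eq_restrict_Icc]
  have h0 : (0 : ℝ) ∈ Icc (0 : ℝ) 1 := left_mem_Icc.2 zero_le_one
  refine funext fun i => ?_
  fin_cases i
  exacts [extend_sol_zero hq z c 0 ▸ hsol h0, extend_solDeriv_zero hq z c 0 ▸ hderiv0 h0]

theorem integral_norm_sq_sol_pos {z : ℂ} {c : Fin 2 → ℂ} (hc : c ≠ 0) :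
    0 < ∫ s in (0 : ℝ)..1, ‖extend (sol hq z c 0) s‖ ^ 2 := by
  refine lt_of_le_of_ne (intervalIntegral.integral_nonneg zero_le_one fun _ _ => by positivity)
    fun h => hc (initial_eq_zero_of_toL2_sol_eq_zero hq (z := z) ?_)
  rw [eq_comm, intervalIntegral.integral_of_le zero_le_one, integral_eq_zero_iff_of_nonneg
    (fun _ => by positivity) ((Continuous.intervalIntegrable (by fun_prop) 0 1).1)] at h
  apply Lp.ext
  filter_upwards [h, toL2_coeFn (sol hq z c 0),
    Lp.coeFn_zero ℂ 2 (volume.restrict (Ioc (0 : ℝ) 1))] with s h1 h2 h3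
  rw [h2, h3]
  simpa using h1

end InitialValueProblem

end Hill

namespace UnboundedOp

/-! ### Graphs, root subspaces and resolvents -/

variable {E : Type*} [NormedAddCommGroup E] [NormedSpace ℂ E] {T : E →ₗ.[ℂ] E} {z w : ℂ}
  {R : E →L[ℂ] E} {v : E}

theorem exists_apply_eq_iff_mem_graph {u : E} :
    (∃ h : v ∈ T.domain, T ⟨v, h⟩ = u) ↔ (v, u) ∈ T.graph := by
  simp [LinearPMap.mem_graph_iff]

theorem isResolvent_iff : IsResolvent T z R ↔
    (∀ f, (R f, f + z • R f) ∈ T.graph) ∧ ∀ v u, (v, u) ∈ T.graph → R (u - z • v) = v := by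
  simp only [← exists_apply_eq_iff_mem_graph, IsResolvent, sub_eq_iff_eq_add]
  refine and_congr_right fun _ => ⟨?_, fun h v => h v (T v) ⟨v.2, rfl⟩⟩
  rintro h v _ ⟨hv, rfl⟩
  exact h ⟨v, hv⟩

theorem mem_kerPow_succ {n : ℕ} :
    v ∈ kerPow T z (n + 1) ↔ ∃ u ∈ kerPow T z n, (v, u + z • v) ∈ T.graph := by
  simp only [kerPow, Submodule.mem_map, Submodule.mem_comap, ← exists_apply_eq_iff_mem_graph]
  constructor
  · rintro ⟨⟨v, hv⟩, hu, rfl⟩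
    exact ⟨_, hu, hv, (sub_add_cancel _ _).symm⟩
  · rintro ⟨u, hu, hv, he⟩
    refine ⟨⟨v, hv⟩, ?_, rfl⟩
    simpa [← sub_eq_iff_eq_add.2 he] using hu

theorem rootSpace_le {S : Submodule ℂ E}
    (h : ∀ v u, (v, u + z • v) ∈ T.graph → u ∈ S → v ∈ S) : rootSpace T z ≤ S := by
  refine iSup_le fun n => ?_
  induction n with
  | zero => exact bot_le
  | succ n ih =>
    intro v hv
    obtain ⟨u, hu, hvu⟩ := mem_kerPow_succ.1 hv
    exact h v u hvu (ih hu)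

theorem mem_rootSpace_of_mem_graph (hv : (v, z • v) ∈ T.graph) : v ∈ rootSpace T z :=
  le_iSup (kerPow T z) 1 (mem_kerPow_succ.2 ⟨0, Submodule.zero_mem _, by rwa [zero_add]⟩)

theorem IsSimpleEigenvalue.of_rootSpace_eq_span (hv : v ≠ 0)
    (h : rootSpace T z = Submodule.span ℂ {v}) : IsSimpleEigenvalue T z := by
  rw [IsSimpleEigenvalue, algMult, h, ← Module.finrank_eq_rank, finrank_span_singleton hv]
  simp

theorem IsResolvent.apply_of_mem_graph (hR : IsResolvent T z R) (hwz : w ≠ z)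
    (hv : (v, w • v) ∈ T.graph) : R v = (w - z)⁻¹ • v := by
  have h := (isResolvent_iff.1 hR).2 v _ hv
  rw [← sub_smul, map_smul] at h
  rw [eq_inv_smul_iff₀ (sub_ne_zero.2 hwz), h]

theorem IsResolvent.algMult_eq_zero (hR : IsResolvent T z R) : algMult T z = 0 := by
  have h : rootSpace T z = ⊥ := by
    refine le_bot_iff.1 (rootSpace_le fun v u hv hu => ?_)
    rw [(Submodule.mem_bot ℂ).1 hu] at hv
    simpa [eq_comm] using (isResolvent_iff.1 hR).2 v _ hv
  rw [algMult, h, rank_bot, map_zero]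

theorem mem_spectrum_of_mem_graph (hv0 : v ≠ 0) (hv : (v, z • v) ∈ T.graph) :
    z ∈ spectrum T := by
  rintro ⟨R, hR⟩
  have h := (isResolvent_iff.1 hR).2 v _ hv
  rw [sub_self, map_zero] at h
  exact hv0 h.symm

theorem IsResolvent.norm_le_of_mem_graph (hR : IsResolvent T z R) {y r : E}
    (h : (y, r + z • y) ∈ T.graph) : ‖y‖ ≤ ‖R‖ * ‖r‖ := by
  have hRr := (isResolvent_iff.1 hR).2 _ _ h
  rw [add_sub_cancel_right] at hRr
  exact hRr ▸ R.le_opNorm r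

theorem mem_spectrum_of_unbounded {C : ℝ}
    (h : ∀ B : ℝ, ∃ y r : E, (y, r + z • y) ∈ T.graph ∧ ‖r‖ ≤ C ∧ B < ‖y‖) : z ∈ spectrum T := by
  rintro ⟨R, hR⟩
  obtain ⟨y, r, hy, hr, hB⟩ := h (‖R‖ * C)
  refine hB.not_ge ((hR.norm_le_of_mem_graph hy).trans ?_)
  gcongr

theorem isNormalizedEigenvector_iff :
    IsNormalizedEigenvector T z v ↔ ‖v‖ = 1 ∧ (v, z • v) ∈ T.graph :=
  and_congr_right fun _ => exists_apply_eq_iff_mem_graph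

/-! ### Spectral projections -/

theorem IsResolvent.mul_one_sub_smul {z₀ : ℂ} {R₀ : E →L[ℂ] E} (h₀ : IsResolvent T z₀ R₀)
    (hR : IsResolvent T z R) : R * (1 - (z - z₀) • R₀) = R₀ := by
  ext f
  have h := (isResolvent_iff.1 hR).2 _ _ ((isResolvent_iff.1 h₀).1 f)
  have hf : f + z₀ • R₀ f - z • R₀ f = f - (z - z₀) • R₀ f := by module
  rw [hf] at h
  simpa using h

theorem continuousOn_resolvent [CompleteSpace E] {s : Set ℂ} {R : ℂ → E →L[ℂ] E}
    (hR : ∀ z ∈ s, IsResolvent T z (R z)) : ContinuousOn R s := by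
  intro z₀ hz₀
  let A : ℂ → E →L[ℂ] E := fun z => 1 - (z - z₀) • R z₀
  have hA : ContinuousAt A z₀ := by fun_prop
  have hA₀ : A z₀ = (1 : (E →L[ℂ] E)ˣ) := by simp [A]
  have hinv : ContinuousAt (fun z => R z₀ * Ring.inverse (A z)) z₀ :=
    continuousAt_const.mul (ContinuousAt.comp (g := Ring.inverse)
      (hA₀ ▸ NormedRing.inverse_continuousAt 1) hA)
  have hunit : ∀ᶠ z in 𝓝 z₀, IsUnit (A z) :=
    hA.eventually (Units.isOpen.mem_nhds (hA₀ ▸ isUnit_one))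
  have heq : ∀ z ∈ s, IsUnit (A z) → R z = R z₀ * Ring.inverse (A z) := fun z hz hu => by
    rw [← (hR z₀ hz₀).mul_one_sub_smul (hR z hz), mul_assoc, Ring.mul_inverse_cancel _ hu, mul_one]
  refine hinv.continuousWithinAt.congr_of_eventuallyEq ?_ (heq z₀ hz₀ (hA₀ ▸ isUnit_one))
  filter_upwards [mem_nhdsWithin_of_mem_nhds hunit, self_mem_nhdsWithin] with z hu hz
  exact heq z hz hu

theorem circleIntegral_resolvent_apply [CompleteSpace E] {r : ℝ} (hr : 0 < r)
    {R : ℂ → E →L[ℂ] E} (hR : ∀ z ∈ Metric.sphere w r, IsResolvent T z (R z))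
    (hv : (v, z • v) ∈ T.graph) (hz : z ∉ Metric.sphere w r) :
    (∮ ζ in C(w, r), R ζ) v = (∮ ζ in C(w, r), (z - ζ)⁻¹) • v := by
  have hint : CircleIntegrable R w r := (continuousOn_resolvent hR).circleIntegrable hr.le
  have happly : (∮ ζ in C(w, r), R ζ) v = ∮ ζ in C(w, r), R ζ v := by
    simp only [circleIntegral]
    rw [← ContinuousLinearMap.apply_apply (𝕜 := ℂ) v,
      ← ContinuousLinearMap.intervalIntegral_comp_comm _ hint.out]
    simp
  rw [happly, ← circleIntegral.integral_smul_const]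
  exact circleIntegral.integral_congr hr.le fun ζ hζ =>
    (hR ζ hζ).apply_of_mem_graph (by rintro rfl; exact hz hζ) hv

theorem circleIntegral_sub_inv_self {r : ℝ} (hr : 0 < r) :
    (∮ ζ in C(w, r), (w - ζ)⁻¹) = -(2 * (Real.pi : ℂ) * Complex.I) := by
  rw [← circleIntegral.integral_sub_center_inv w hr.ne']
  simp only [circleIntegral, ← intervalIntegral.integral_neg]
  congr 1
  ext θ
  rw [← neg_sub, inv_neg, smul_neg]

theorem circleIntegral_sub_inv_of_notMem {r : ℝ} (hr : 0 < r) (hz : z ∉ Metric.closedBall w r) :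
    (∮ ζ in C(w, r), (z - ζ)⁻¹) = 0 := by
  have hne : ∀ ζ ∈ Metric.closedBall w r, z - ζ ≠ 0 := fun ζ hζ h0 =>
    hz (sub_eq_zero.1 h0 ▸ hζ)
  refine Complex.circleIntegral_eq_zero_of_differentiable_on_off_countable hr.le
    countable_empty (ContinuousOn.inv₀ (by fun_prop) hne) fun ζ hζ => ?_
  exact DifferentiableAt.inv (by fun_prop) (hne ζ (Metric.ball_subset_closedBall hζ.1))

theorem IsSpectralProjection.apply_of_mem_graph [CompleteSpace E] {P : E →L[ℂ] E}
    (hP : IsSpectralProjection T w P) (hv : (v, w • v) ∈ T.graph) : P v = v := by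
  obtain ⟨r, hr, -, R, hR, rfl⟩ := hP
  rw [smul_apply, circleIntegral_resolvent_apply hr hR hv (by simp [hr.ne]),
    circleIntegral_sub_inv_self hr, smul_smul, neg_mul_neg,
    inv_mul_cancel₀ Complex.two_pi_I_ne_zero, one_smul]

theorem IsSpectralProjection.apply_of_mem_graph_of_ne [CompleteSpace E] {P : E →L[ℂ] E}
    (hP : IsSpectralProjection T w P) (hzw : z ≠ w) (hv : (v, z • v) ∈ T.graph) : P v = 0 := by
  by_cases hv0 : v = 0
  · rw [hv0, map_zero]
  obtain ⟨r, hr, hs, R, hR, rfl⟩ := hP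
  have hz : z ∉ Metric.closedBall w r := fun h => hzw (hs ⟨h, mem_spectrum_of_mem_graph hv0 hv⟩)
  rw [smul_apply, circleIntegral_resolvent_apply hr hR hv
    (fun h => hz (Metric.sphere_subset_closedBall h)), circleIntegral_sub_inv_of_notMem hr hz,
    zero_smul, smul_zero]

theorem IsSpectralProjection.norm_le_mul_norm_sub [CompleteSpace E] {P : E →L[ℂ] E}
    (hP : IsSpectralProjection T w P) {u v : E} (hu : (u, w • u) ∈ T.graph)
    (hv : (v, z • v) ∈ T.graph) (hzw : z ≠ w) : ‖u‖ ≤ ‖P‖ * ‖u - v‖ :=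
  calc ‖u‖ = ‖P (u - v)‖ := by
        rw [map_sub, hP.apply_of_mem_graph hu, hP.apply_of_mem_graph_of_ne hzw hv, sub_zero]
    _ ≤ ‖P‖ * ‖u - v‖ := P.le_opNorm _

theorem exists_isSpectralProjection (h : ∀ᶠ z in 𝓝[≠] w, z ∈ resolventSet T) :
    ∃ P, IsSpectralProjection T w P := by
  obtain ⟨ε, hε, hball⟩ := Metric.eventually_nhds_iff.1 (eventually_nhdsWithin_iff.1 h)
  have hres : ∀ z ∈ Metric.closedBall w (ε / 2), z ≠ w → z ∈ resolventSet T := fun z hz =>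
    hball (lt_of_le_of_lt hz (half_lt_self hε))
  have hsphere : ∀ z ∈ Metric.sphere w (ε / 2), z ∈ resolventSet T := fun z hz =>
    hres z (Metric.sphere_subset_closedBall hz) (Metric.ne_of_mem_sphere hz (half_pos hε).ne')
  choose! R hR using hsphere
  exact ⟨_, ε / 2, half_pos hε, fun z hz => by_contra fun hne => hz.2 (hres z hz.1 hne), R, hR, rfl⟩

end UnboundedOp

namespace Hill

/-! ### Matrices of size two -/

section TwoByTwo

open Matrix

theorem adjugate_mulVec_mulVec {R : Type*} [CommRing R] {B : Matrix (Fin 2) (Fin 2) R}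
    (X : Matrix (Fin 2) (Fin 2) R) {a : Fin 2 → R} (ha : B *ᵥ a = 0) :
    B.adjugate *ᵥ (X *ᵥ a) = (B.adjugate * X).trace • a := by
  have h0 : B 0 0 * a 0 + B 0 1 * a 1 = 0 := by simpa [mulVec, dotProduct] using congrFun ha 0
  have h1 : B 1 0 * a 0 + B 1 1 * a 1 = 0 := by simpa [mulVec, dotProduct] using congrFun ha 1
  ext i
  fin_cases i <;> simp [adjugate_fin_two, mulVec, vecMul, dotProduct, trace_fin_two]
  · linear_combination (-X 1 1) * h0 + X 0 1 * h1
  · linear_combination X 1 0 * h0 - X 0 0 * h1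

variable {K : Type*} [Field K] {B : Matrix (Fin 2) (Fin 2) K}

theorem exists_eq_smul_of_mulVec_eq_zero (hB : B ≠ 0) {a b : Fin 2 → K} (ha0 : a ≠ 0)
    (ha : B *ᵥ a = 0) (hb : B *ᵥ b = 0) : ∃ k : K, b = k • a := by
  let A : Matrix (Fin 2) (Fin 2) K := (of ![a, b])ᵀ
  have hA : ∀ v, A *ᵥ v = v 0 • a + v 1 • b := fun v => by
    ext i; simp [A, mulVec, dotProduct, mul_comm]
  have hBA : B * A = 0 := by
    refine ext_of_mulVec_single fun i => ?_
    rw [← mulVec_mulVec, hA, mulVec_add, mulVec_smul, mulVec_smul, ha, hb,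
      smul_zero, smul_zero, add_zero, zero_mulVec]
  have hdet : A.det = 0 := by
    by_contra h
    refine hB ?_
    rw [← mul_nonsing_inv_cancel_right A B (Ne.isUnit h), hBA, Matrix.zero_mul]
  obtain ⟨v, hv0, hv⟩ := exists_mulVec_eq_zero_iff.2 hdet
  rw [hA] at hv
  have hv1 : v 1 ≠ 0 := fun h1 => by
    rw [h1, zero_smul, add_zero] at hv
    refine hv0 (funext fun i => ?_)
    fin_cases i
    exacts [(smul_eq_zero.1 hv).resolve_right ha0, h1]
  refine ⟨-(v 0 / v 1), ?_⟩
  rw [neg_smul, div_eq_inv_mul, mul_smul, ← smul_neg, eq_inv_smul_iff₀ hv1,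
    ← eq_neg_of_add_eq_zero_right hv]

theorem exists_mulVec_eq_of_adjugate_mulVec_eq_zero (hB : B ≠ 0) {v : Fin 2 → K}
    (hv : B.adjugate *ᵥ v = 0) : ∃ b, B *ᵥ b = v := by
  by_cases hdet : B.det = 0
  · obtain ⟨b, hb⟩ : ∃ b, B *ᵥ b ≠ 0 := by
      by_contra! h
      exact hB (ext_of_mulVec_single fun i => by rw [h, zero_mulVec])
    have hadj : B.adjugate ≠ 0 := fun h => hB (by simpa [h] using (adjugate_adjugate' B).symm)
    obtain ⟨k, hk⟩ := exists_eq_smul_of_mulVec_eq_zero hadj hb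
      (by rw [mulVec_mulVec, adjugate_mul, hdet, zero_smul, zero_mulVec]) hv
    exact ⟨k • b, by rw [mulVec_smul, hk]⟩
  · refine ⟨0, ?_⟩
    have h : B.det • v = 0 := by
      rw [← one_mulVec v, ← smul_mulVec, ← mul_adjugate, ← mulVec_mulVec, hv, mulVec_zero]
    rw [mulVec_zero, (smul_eq_zero.1 h).resolve_left hdet]

end TwoByTwo

/-! ### The monodromy matrix and the discriminant -/

section Monodromy

open Matrix

/-- Multiplication of vectors in `ℂ²` by a matrix. -/
noncomputable def mulVecCLM :
    Matrix (Fin 2) (Fin 2) ℂ →ₗ[ℂ] (Fin 2 → ℂ) →L[ℂ] (Fin 2 → ℂ) :=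
  LinearMap.toContinuousLinearMap.toLinearMap ∘ₗ (Matrix.toLin' (R := ℂ)).toLinearMap

variable {q : ℝ → ℂ} (hq : IntervalIntegrable q volume 0 1)

/-- The monodromy matrix `(y(0), y'(0)) ↦ (y(1), y'(1))` of `-y'' + q y = z y`. -/
noncomputable def monodromy (z : ℂ) : Matrix (Fin 2) (Fin 2) ℂ :=
  LinearMap.toMatrix' ((endpoint.comp (solver hq z)).comp constCurve)

/-- The end values of the solution of `-y'' + (q - z) y = h` with vanishing initial values. -/
noncomputable def endSource (z : ℂ) : L2Unit →L[ℂ] (Fin 2 → ℂ) :=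
  (endpoint.comp (solver hq z)).comp source

/-- The derivative of the monodromy matrix with respect to the spectral parameter. -/
noncomputable def monodromyDeriv (z : ℂ) : Matrix (Fin 2) (Fin 2) ℂ :=
  LinearMap.toMatrix'
    (-(endpoint.comp (solver hq z * spectralVolterra * solver hq z)).comp constCurve)

/-- The solution of `-y'' + q y = z y` with `(y(0), y'(0)) = c` as an element of `L²(0, 1)`. -/
noncomputable def solL2 (z : ℂ) : (Fin 2 → ℂ) →L[ℂ] L2Unit :=
  ((toL2.comp (component 0)).comp (solver hq z)).comp constCurve

/-- The Hill discriminant. -/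
noncomputable def discriminant (z : ℂ) : ℂ := (monodromy hq z).trace

/-- The matrix whose kernel consists of the initial values `(y(0), y'(0))` of the solutions of
`-y'' + q y = z y` that satisfy the boundary conditions of `H_t`. -/
noncomputable def floquetMatrix (t : ℝ) (z : ℂ) : Matrix (Fin 2) (Fin 2) ℂ :=
  monodromy hq z - Complex.exp (Complex.I * t) • 1

theorem solL2_apply (z : ℂ) (c : Fin 2 → ℂ) : solL2 hq z c = toL2 (sol hq z c 0) := by
  rw [sol, solPair, map_zero, add_zero]
  rfl

theorem solL2_eq_zero_iff {z : ℂ} {c : Fin 2 → ℂ} : solL2 hq z c = 0 ↔ c = 0 :=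
  ⟨fun h => initial_eq_zero_of_toL2_sol_eq_zero hq (solL2_apply hq z c ▸ h),
    fun h => h ▸ map_zero _⟩

theorem monodromy_mulVec (z : ℂ) (c : Fin 2 → ℂ) :
    monodromy hq z *ᵥ c = endpoint (solPair hq z c 0) := by
  rw [monodromy, LinearMap.toMatrix'_mulVec, solPair, map_zero, add_zero]
  rfl

theorem endpoint_solPair (z : ℂ) (c : Fin 2 → ℂ) (h : L2Unit) :
    endpoint (solPair hq z c h) = monodromy hq z *ᵥ c + endSource hq z h := by
  rw [monodromy_mulVec, solPair, solPair, map_zero, add_zero, map_add, map_add]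
  rfl

theorem floquetMatrix_mulVec (t : ℝ) (z : ℂ) (c : Fin 2 → ℂ) :
    floquetMatrix hq t z *ᵥ c = monodromy hq z *ᵥ c - Complex.exp (Complex.I * t) • c := by
  rw [floquetMatrix, sub_mulVec, smul_mulVec, one_mulVec]

theorem monodromy_apply (z : ℂ) (i j : Fin 2) :
    monodromy hq z i j = endpoint (solPair hq z (Pi.single j 1) 0) i := by
  rw [← monodromy_mulVec, mulVec_single_one]
  rfl

/-- The Wronskian of two solutions of `-y'' + q y = z y` is constant. -/
theorem det_monodromy (z : ℂ) : (monodromy hq z).det = 1 := by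
  let y (j : Fin 2) : ℝ → ℂ := extend (sol hq z (Pi.single j 1) 0)
  let y' (j : Fin 2) : ℝ → ℂ := extend (solDeriv hq z (Pi.single j 1) 0)
  have hy (j) := isPrimitiveOn_sol hq z (Pi.single j 1) 0
  have hy' (j) := isPrimitiveOn_solDeriv hq z (Pi.single j 1) 0
  have hW := ((hy 0).mul zero_le_one (hy' 1)).sub ((hy 1).mul zero_le_one (hy' 0))
  have hW1 : y 0 1 * y' 1 1 - y 1 1 * y' 0 1 = y 0 0 * y' 1 0 - y 1 0 * y' 0 0 := by
    have h := hW.integral_eq_sub (left_mem_Icc.2 zero_le_one) (right_mem_Icc.2 zero_le_one)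
    rw [integral_congr_of_ae_unit (g := fun _ => 0) ?_ (right_mem_Icc.2 zero_le_one)] at h
    · rw [intervalIntegral.integral_zero] at h
      linear_combination -h
    · filter_upwards [Lp.coeFn_zero ℂ 2 (volume.restrict (Ioc (0 : ℝ) 1))] with x hx
      rw [hx, Pi.zero_apply]
      ring
  simp only [y, y', extend_sol_zero, extend_solDeriv_zero] at hW1
  simp only [det_fin_two, monodromy_apply, endpoint_apply]
  exact hW1.trans (by simp)

theorem source_toL2 (Y : C(unitInterval, Fin 2 → ℂ)) :
    source (toL2 (component 0 Y)) = -spectralVolterra Y := by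
  ext1 x
  rw [source_apply, ContinuousMap.neg_apply, spectralVolterra_apply,
    integral_congr_of_ae_unit (toL2_coeFn (component 0 Y)) x.2]
  simp [extend_component]

theorem monodromyDeriv_mulVec (z : ℂ) (c : Fin 2 → ℂ) :
    monodromyDeriv hq z *ᵥ c = endSource hq z (solL2 hq z c) := by
  rw [solL2_apply, monodromyDeriv, LinearMap.toMatrix'_mulVec, endSource, sol,
    ContinuousLinearMap.comp_apply, source_toL2, map_neg, solPair, map_zero, add_zero]
  rfl

theorem hasDerivAt_monodromy_apply (z : ℂ) (i j : Fin 2) :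
    HasDerivAt (fun z => monodromy hq z i j) (monodromyDeriv hq z i j) z := by
  have h := hasDerivAt_comp_solver_comp hq endpoint constCurve z
  simpa [monodromy, monodromyDeriv, LinearMap.toMatrix'_apply] using
    hasDerivAt_pi.1 (h.clm_apply (hasDerivAt_const z (Pi.single j 1))) i

theorem hasDerivAt_discriminant (z : ℂ) :
    HasDerivAt (discriminant hq) (monodromyDeriv hq z).trace z := by
  unfold discriminant
  simp only [trace_fin_two]
  exact (hasDerivAt_monodromy_apply hq z 0 0).add (hasDerivAt_monodromy_apply hq z 1 1)

theorem differentiable_discriminant : Differentiable ℂ (discriminant hq) := fun z =>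
  (hasDerivAt_discriminant hq z).differentiableAt

theorem trace_adjugate_monodromy_mul (z : ℂ) :
    ((monodromy hq z).adjugate * monodromyDeriv hq z).trace = 0 := by
  have hdet := ((hasDerivAt_monodromy_apply hq z 0 0).mul (hasDerivAt_monodromy_apply hq z 1 1)).sub
    ((hasDerivAt_monodromy_apply hq z 0 1).mul (hasDerivAt_monodromy_apply hq z 1 0))
  have hconst : HasDerivAt (fun z => (monodromy hq z).det) 0 z := by
    simp only [det_monodromy]
    exact hasDerivAt_const z 1
  simp only [det_fin_two] at hconst
  rw [← hdet.unique hconst, trace_fin_two, adjugate_fin_two]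
  simp [mul_apply, Fin.sum_univ_two]
  ring

theorem adjugate_floquetMatrix (t : ℝ) (z : ℂ) : (floquetMatrix hq t z).adjugate =
    (monodromy hq z).adjugate - Complex.exp (Complex.I * t) • 1 := by
  ext i j
  fin_cases i <;> fin_cases j <;> simp [floquetMatrix, adjugate_fin_two]

/-- The operator `h ↦ adj (M(z) - e^{it}) v`, where `v` are the end values of the solution of
`-y'' + (q - z) y = h` with vanishing initial values. By Cramer's rule it is, up to a scalar factor,
the operator assigning to `h` the initial values of `(H_t - z)⁻¹ h`. -/
noncomputable def adjugateSource (t : ℝ) (z : ℂ) : L2Unit →L[ℂ] (Fin 2 → ℂ) :=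
  (mulVecCLM (floquetMatrix hq t z).adjugate).comp (endSource hq z)

theorem adjugateSource_apply (t : ℝ) (z : ℂ) (h : L2Unit) : adjugateSource hq t z h =
    (floquetMatrix hq t z).adjugate *ᵥ endSource hq z h := rfl

/-- The trace of `adj (M - μ) M'` is `-μ F'`, because `det M = 1` has derivative zero. -/
theorem adjugateSource_solL2 {t : ℝ} {z : ℂ} {a : Fin 2 → ℂ}
    (ha : floquetMatrix hq t z *ᵥ a = 0) :
    adjugateSource hq t z (solL2 hq z a) =
      (-Complex.exp (Complex.I * t) * deriv (discriminant hq) z) • a := by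
  rw [adjugateSource_apply, ← monodromyDeriv_mulVec, adjugate_mulVec_mulVec _ ha,
    adjugate_floquetMatrix, Matrix.sub_mul, trace_sub, trace_adjugate_monodromy_mul, smul_mul,
    one_mul, trace_smul, (hasDerivAt_discriminant hq z).deriv, zero_sub, smul_eq_mul, neg_mul]

theorem det_floquetMatrix (t : ℝ) (z : ℂ) : (floquetMatrix hq t z).det =
    Complex.exp (Complex.I * t) * (2 * Real.cos t - discriminant hq z) := by
  have hdet : (floquetMatrix hq t z).det = (monodromy hq z).det -
      discriminant hq z * Complex.exp (Complex.I * t) + Complex.exp (Complex.I * t) ^ 2 := by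
    simp [floquetMatrix, discriminant, det_fin_two, trace_fin_two]
    ring
  have hcos : 2 * (Real.cos t : ℂ) =
      Complex.exp (Complex.I * t) + Complex.exp (-(Complex.I * t)) := by
    rw [Complex.ofReal_cos, Complex.two_cos, mul_comm Complex.I, neg_mul]
  have hexp : Complex.exp (Complex.I * t) * Complex.exp (-(Complex.I * t)) = 1 := by
    rw [← Complex.exp_add, add_neg_cancel, Complex.exp_zero]
  rw [hdet, hcos, det_monodromy]
  linear_combination -hexp

theorem det_floquetMatrix_eq_zero_iff {t : ℝ} {z : ℂ} :
    (floquetMatrix hq t z).det = 0 ↔ discriminant hq z = 2 * Real.cos t := by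
  rw [det_floquetMatrix, mul_eq_zero, or_iff_right (Complex.exp_ne_zero _), sub_eq_zero, eq_comm]

/-! ### Resolvents and eigenvalues of `H_t` -/

theorem mem_fibreGraph_iff (t : ℝ) (z : ℂ) (y h : L2Unit) :
    (y, h + z • y) ∈ fibreGraph q t ↔
      ∃ c, y = toL2 (sol hq z c h) ∧ floquetMatrix hq t z *ᵥ c = -endSource hq z h := by
  simp only [mem_fibreGraph_iff_endpoint hq, endpoint_solPair, floquetMatrix_mulVec,
    eq_neg_iff_add_eq_zero, sub_add_eq_add_sub, sub_eq_zero]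

theorem mem_fibreGraph_smul_iff (t : ℝ) (z : ℂ) (y : L2Unit) :
    (y, z • y) ∈ fibreGraph q t ↔
      ∃ c, y = solL2 hq z c ∧ floquetMatrix hq t z *ᵥ c = 0 := by
  simpa [solL2_apply] using mem_fibreGraph_iff hq t z y 0

theorem floquetMatrix_mulVec_eq_iff {t : ℝ} {z : ℂ} (hz : discriminant hq z ≠ 2 * Real.cos t)
    (c : Fin 2 → ℂ) (h : L2Unit) :
    floquetMatrix hq t z *ᵥ c = -endSource hq z h ↔
      c = -(floquetMatrix hq t z).det⁻¹ • adjugateSource hq t z h := by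
  have hdet := mt (det_floquetMatrix_eq_zero_iff hq).1 hz
  rw [adjugateSource_apply]
  constructor <;> intro hc
  · rw [neg_smul, ← smul_neg, ← mulVec_neg, ← hc, mulVec_mulVec, adjugate_mul, smul_mulVec,
      one_mulVec, inv_smul_smul₀ hdet]
  · rw [hc, mulVec_smul, mulVec_mulVec, mul_adjugate, smul_mulVec, one_mulVec, neg_smul,
      inv_smul_smul₀ hdet]

/-- The resolvent of `H_t` in terms of the initial value problem. -/
noncomputable def fibreResolvent (t : ℝ) (z : ℂ) : L2Unit →L[ℂ] L2Unit :=
  toL2.comp ((component 0).comp ((solver hq z).comp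
    (constCurve.comp (-(floquetMatrix hq t z).det⁻¹ • adjugateSource hq t z) + source)))

theorem fibreResolvent_apply (t : ℝ) (z : ℂ) (h : L2Unit) : fibreResolvent hq t z h =
    toL2 (sol hq z (-(floquetMatrix hq t z).det⁻¹ • adjugateSource hq t z h) h) := rfl

theorem isResolvent_fibreResolvent {t : ℝ} {z : ℂ} (hz : discriminant hq z ≠ 2 * Real.cos t) :
    UnboundedOp.IsResolvent (fibreOp q t) z (fibreResolvent hq t z) := by
  have hgraph (y h : L2Unit) : (y, h + z • y) ∈ fibreGraph q t ↔ y = fibreResolvent hq t z h := by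
    simp only [mem_fibreGraph_iff hq, floquetMatrix_mulVec_eq_iff hq hz, exists_eq_right,
      fibreResolvent_apply]
  rw [UnboundedOp.isResolvent_iff, fibreOp_graph]
  refine ⟨fun h => (hgraph _ h).2 rfl, fun y g hyg => ((hgraph y _).1 ?_).symm⟩
  rwa [sub_add_cancel]

theorem discriminant_eq_of_mem_spectrum {t : ℝ} {z : ℂ}
    (hz : z ∈ UnboundedOp.spectrum (fibreOp q t)) : discriminant hq z = 2 * Real.cos t :=
  by_contra fun h => hz ⟨_, isResolvent_fibreResolvent hq h⟩

theorem mul_deriv_discriminant_ne_zero {t : ℝ} {z : ℂ} (hd : deriv (discriminant hq) z ≠ 0) :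
    -Complex.exp (Complex.I * t) * deriv (discriminant hq) z ≠ 0 :=
  mul_ne_zero (neg_ne_zero.2 (Complex.exp_ne_zero _)) hd

theorem floquetMatrix_ne_zero {t : ℝ} {z : ℂ} (hd : deriv (discriminant hq) z ≠ 0) :
    floquetMatrix hq t z ≠ 0 := fun h => by
  have hadj := adjugateSource_solL2 hq (t := t) (a := 1) (by rw [h, zero_mulVec])
  rw [adjugateSource_apply, h, adjugate_zero, zero_mulVec] at hadj
  exact smul_ne_zero (mul_deriv_discriminant_ne_zero hq hd) one_ne_zero hadj.symm

theorem exists_eq_smul_sol_of_mem_fibreGraph {t : ℝ} {z k : ℂ} {a : Fin 2 → ℂ} {y : L2Unit}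
    (hd : deriv (discriminant hq) z ≠ 0) (ha0 : a ≠ 0) (ha : floquetMatrix hq t z *ᵥ a = 0)
    (hy : (y, k • solL2 hq z a + z • y) ∈ fibreGraph q t) :
    ∃ l : ℂ, y = l • solL2 hq z a := by
  have hdet : (floquetMatrix hq t z).det = 0 := exists_mulVec_eq_zero_iff.1 ⟨a, ha0, ha⟩
  obtain ⟨b, rfl, hb⟩ := (mem_fibreGraph_iff hq t z y _).1 hy
  have hk : k = 0 := by
    have h := congrArg ((floquetMatrix hq t z).adjugate *ᵥ ·) hb
    simp only [mulVec_mulVec, adjugate_mul, hdet, zero_smul, zero_mulVec, map_smul, mulVec_neg,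
      mulVec_smul, ← adjugateSource_apply, adjugateSource_solL2 hq ha, zero_eq_neg] at h
    exact (smul_eq_zero.1 h).resolve_right
      (smul_ne_zero (mul_deriv_discriminant_ne_zero hq hd) ha0)
  rw [hk, zero_smul, map_zero, neg_zero] at hb
  obtain ⟨l, rfl⟩ := exists_eq_smul_of_mulVec_eq_zero (floquetMatrix_ne_zero hq hd) ha0 ha hb
  exact ⟨l, by rw [hk, zero_smul, ← solL2_apply, map_smul]⟩

theorem isSimpleEigenvalue_of_deriv_ne_zero {t : ℝ} {z : ℂ}
    (hz : discriminant hq z = 2 * Real.cos t) (hd : deriv (discriminant hq) z ≠ 0) :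
    UnboundedOp.IsSimpleEigenvalue (fibreOp q t) z := by
  obtain ⟨a, ha0, ha⟩ := exists_mulVec_eq_zero_iff.2 ((det_floquetMatrix_eq_zero_iff hq).2 hz)
  have hgraph : (solL2 hq z a, z • solL2 hq z a) ∈ (fibreOp q t).graph := by
    rw [fibreOp_graph, mem_fibreGraph_smul_iff hq]
    exact ⟨a, rfl, ha⟩
  refine .of_rootSpace_eq_span (v := solL2 hq z a)
    (mt (solL2_eq_zero_iff hq).1 ha0) (le_antisymm
    (UnboundedOp.rootSpace_le fun y h hyh hh => ?_)
    ((Submodule.span_singleton_le_iff_mem _ _).2 (UnboundedOp.mem_rootSpace_of_mem_graph hgraph)))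
  obtain ⟨k, rfl⟩ := Submodule.mem_span_singleton.1 hh
  rw [fibreOp_graph] at hyh
  obtain ⟨l, rfl⟩ := exists_eq_smul_sol_of_mem_fibreGraph hq hd ha0 ha hyh
  exact Submodule.smul_mem _ _ (Submodule.mem_span_singleton_self _)

theorem discriminant_of_isMultipleEigenvalue {t : ℝ} {z : ℂ}
    (hz : UnboundedOp.IsMultipleEigenvalue (fibreOp q t) z) :
    discriminant hq z = 2 * Real.cos t ∧ deriv (discriminant hq) z = 0 := by
  rw [UnboundedOp.IsMultipleEigenvalue] at hz
  have hF : discriminant hq z = 2 * Real.cos t := by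
    by_contra h
    simp [(isResolvent_fibreResolvent hq h).algMult_eq_zero] at hz
  refine ⟨hF, by_contra fun h => ?_⟩
  rw [isSimpleEigenvalue_of_deriv_ne_zero hq hF h] at hz
  exact absurd hz (by decide)

end Monodromy

/-! ### A half-line in the resolvent sets, and density of the domains -/

theorem exp_mul_conj (t : ℝ) :
    Complex.exp (Complex.I * t) * starRingEnd ℂ (Complex.exp (Complex.I * t)) = 1 := by
  rw [Complex.mul_conj, Complex.normSq_eq_norm_sq, mul_comm, Complex.norm_exp_ofReal_mul_I,
    one_pow, Complex.ofReal_one]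

section Sobolev

variable {u U : ℝ → ℂ} {k x y : ℝ}

theorem IsPrimitiveOn.norm_sub_le (h : IsPrimitiveOn 0 1 u U) (hx : x ∈ Icc (0 : ℝ) 1)
    (hy : y ∈ Icc (0 : ℝ) 1) : ‖u y - u x‖ ≤ ∫ s in (0 : ℝ)..1, ‖U s‖ := by
  rw [← h.integral_eq_sub hx hy,
    ← abs_of_nonneg (a := ∫ s in (0 : ℝ)..1, ‖U s‖)
      (intervalIntegral.integral_nonneg zero_le_one fun _ _ => norm_nonneg _)]
  refine intervalIntegral.norm_integral_le_abs_integral_norm.trans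
    (intervalIntegral.abs_integral_mono_interval ?_ (ae_of_all _ fun _ => norm_nonneg _)
      h.integrable.norm)
  rw [uIoc_of_le zero_le_one]
  exact Ioc_subset_Ioc (le_min hx.1 hy.1) (max_le hx.2 hy.2)

theorem norm_mul_conj_add_le (hk : 0 < k) (v w : ℂ) :
    ‖w * starRingEnd ℂ v + v * starRingEnd ℂ w‖ ≤ k * ‖v‖ ^ 2 + k⁻¹ * ‖w‖ ^ 2 := by
  have hsq : 0 ≤ k⁻¹ * (k * ‖v‖ - ‖w‖) ^ 2 := by positivity
  have hexpand : k⁻¹ * (k * ‖v‖ - ‖w‖) ^ 2 =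
      k * ‖v‖ ^ 2 + k⁻¹ * ‖w‖ ^ 2 - 2 * (‖v‖ * ‖w‖) := by
    field_simp
    ring
  have htri := norm_add_le (w * starRingEnd ℂ v) (v * starRingEnd ℂ w)
  simp only [norm_mul, RCLike.norm_conj] at htri
  linarith

theorem IsPrimitiveOn.norm_sq_le (h : IsPrimitiveOn 0 1 u U)
    (hU : IntervalIntegrable (fun s => ‖U s‖ ^ 2) volume 0 1) (hk : 0 < k)
    (hx : x ∈ Icc (0 : ℝ) 1) :
    ‖u x‖ ^ 2 ≤ (1 + k) * (∫ s in (0 : ℝ)..1, ‖u s‖ ^ 2) +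
      k⁻¹ * ∫ s in (0 : ℝ)..1, ‖U s‖ ^ 2 := by
  have hu : IntervalIntegrable (fun s => ‖u s‖ ^ 2) volume 0 1 :=
    (h.continuousOn.norm.pow 2).intervalIntegrable_of_Icc zero_le_one
  have hp := h.mul zero_le_one h.conj
  have hbound : ∫ s in (0 : ℝ)..1, ‖U s * starRingEnd ℂ (u s) + u s * starRingEnd ℂ (U s)‖ ≤
      k * (∫ s in (0 : ℝ)..1, ‖u s‖ ^ 2) + k⁻¹ * ∫ s in (0 : ℝ)..1, ‖U s‖ ^ 2 := by
    rw [← intervalIntegral.integral_const_mul, ← intervalIntegral.integral_const_mul,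
      ← intervalIntegral.integral_add (hu.const_mul k) (hU.const_mul k⁻¹)]
    exact intervalIntegral.integral_mono_on zero_le_one hp.integrable.norm
      ((hu.const_mul k).add (hU.const_mul k⁻¹)) fun s _ => norm_mul_conj_add_le hk _ _
  have hdiff : ∀ s ∈ Icc (0 : ℝ) 1, ‖u x‖ ^ 2 -
      (∫ s in (0 : ℝ)..1, ‖U s * starRingEnd ℂ (u s) + u s * starRingEnd ℂ (U s)‖) ≤
        ‖u s‖ ^ 2 := fun s hs => by
    have hs := hp.norm_sub_le hs hx
    rw [Complex.mul_conj, Complex.mul_conj, Complex.normSq_eq_norm_sq,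
      Complex.normSq_eq_norm_sq, ← Complex.ofReal_sub, Complex.norm_real] at hs
    linarith [(le_abs_self _).trans hs]
  have hmean := intervalIntegral.integral_mono_on zero_le_one intervalIntegrable_const hu hdiff
  rw [intervalIntegral.integral_const, sub_zero, one_smul] at hmean
  linarith

end Sobolev

section Density

open Matrix

variable {q : ℝ → ℂ} (hq : IntervalIntegrable q volume 0 1)

theorem sol_quasiperiodic {t : ℝ} {z : ℂ} {c : Fin 2 → ℂ}
    (hc : floquetMatrix hq t z *ᵥ c = 0) :
    extend (sol hq z c 0) 1 = Complex.exp (Complex.I * t) * extend (sol hq z c 0) 0 ∧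
      extend (solDeriv hq z c 0) 1 =
        Complex.exp (Complex.I * t) * extend (solDeriv hq z c 0) 0 := by
  rwa [floquetMatrix_mulVec, monodromy_mulVec, sub_eq_zero, endpoint_solPair_eq_smul_iff] at hc

theorem integral_potential_mul_norm_sq_sol {t : ℝ} {z : ℂ} {c : Fin 2 → ℂ}
    (hc : floquetMatrix hq t z *ᵥ c = 0) :
    ∫ s in (0 : ℝ)..1, q s * (‖extend (sol hq z c 0) s‖ ^ 2 : ℝ) =
      z * (∫ s in (0 : ℝ)..1, ‖extend (sol hq z c 0) s‖ ^ 2 : ℝ) -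
        (∫ s in (0 : ℝ)..1, ‖extend (solDeriv hq z c 0) s‖ ^ 2 : ℝ) := by
  obtain ⟨hend, hend'⟩ := sol_quasiperiodic hq hc
  set f := extend (sol hq z c 0)
  set f₁ := extend (solDeriv hq z c 0)
  have hint : ∫ s in (0 : ℝ)..1, (q s * (‖f s‖ ^ 2 : ℝ) -
      (z * (‖f s‖ ^ 2 : ℝ) - (‖f₁ s‖ ^ 2 : ℝ))) = 0 := by
    have hp := ((isPrimitiveOn_solDeriv hq z c 0).mul zero_le_one
      (isPrimitiveOn_sol hq z c 0).conj).integral_eq_sub (left_mem_Icc.2 zero_le_one)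
        (right_mem_Icc.2 zero_le_one)
    rw [integral_congr_of_ae_unit (g := fun s => q s * (‖f s‖ ^ 2 : ℝ) -
      (z * (‖f s‖ ^ 2 : ℝ) - (‖f₁ s‖ ^ 2 : ℝ))) ?_ (right_mem_Icc.2 zero_le_one)] at hp
    · rw [hp, hend, hend', map_mul]
      linear_combination (f₁ 0 * starRingEnd ℂ (f 0)) * exp_mul_conj t
    · filter_upwards [Lp.coeFn_zero ℂ 2 (volume.restrict (Ioc (0 : ℝ) 1))] with s hs
      rw [hs, Pi.zero_apply, Complex.ofReal_pow, Complex.ofReal_pow, ← Complex.mul_conj',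
        ← Complex.mul_conj']
      ring
  have hqf : IntervalIntegrable (fun s => q s * (‖f s‖ ^ 2 : ℝ)) volume 0 1 :=
    hq.mul_continuousOn (Continuous.continuousOn (by fun_prop))
  rw [intervalIntegral.integral_sub hqf (Continuous.intervalIntegrable (by fun_prop) _ _),
    intervalIntegral.integral_sub (Continuous.intervalIntegrable (by fun_prop) _ _)
      (Continuous.intervalIntegrable (by fun_prop) _ _), intervalIntegral.integral_const_mul,
    intervalIntegral.integral_ofReal, intervalIntegral.integral_ofReal, sub_eq_zero] at hint
  exact hint

theorem discriminant_ne_of_lt {x : ℝ}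
    (hx : x < -((∫ s in (0 : ℝ)..1, ‖q s‖) * (2 + ∫ s in (0 : ℝ)..1, ‖q s‖))) (t : ℝ) :
    discriminant hq x ≠ 2 * Real.cos t := by
  intro heq
  set Q : ℝ := ∫ s in (0 : ℝ)..1, ‖q s‖ with hQ
  have hQ0 : 0 ≤ Q := intervalIntegral.integral_nonneg zero_le_one fun _ _ => norm_nonneg _
  obtain ⟨c, hc0, hc⟩ :=
    exists_mulVec_eq_zero_iff.2 ((det_floquetMatrix_eq_zero_iff hq).2 heq)
  have hform := integral_potential_mul_norm_sq_sol hq hc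
  have hBpos := integral_norm_sq_sol_pos hq (z := x) hc0
  have hsup := fun s hs => (isPrimitiveOn_sol hq x c 0).norm_sq_le
    (Continuous.intervalIntegrable (by fun_prop) 0 1) (add_pos_of_nonneg_of_pos hQ0 one_pos)
    (x := s) hs
  set A := ∫ s in (0 : ℝ)..1, ‖extend (solDeriv hq x c 0) s‖ ^ 2
  set B := ∫ s in (0 : ℝ)..1, ‖extend (sol hq x c 0) s‖ ^ 2
  have hA0 : 0 ≤ A := intervalIntegral.integral_nonneg zero_le_one fun _ _ => by positivity
  have hnorm : ‖∫ s in (0 : ℝ)..1, q s * (‖extend (sol hq x c 0) s‖ ^ 2 : ℝ)‖ ≤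
      Q * ((1 + (Q + 1)) * B + (Q + 1)⁻¹ * A) := by
    rw [hQ, ← intervalIntegral.integral_mul_const]
    refine intervalIntegral.norm_integral_le_of_norm_le zero_le_one (ae_of_all _ fun s hs => ?_)
      (hq.norm.mul_const _)
    rw [norm_mul, Complex.norm_real, Real.norm_of_nonneg (by positivity)]
    exact mul_le_mul_of_nonneg_left (hsup s (Ioc_subset_Icc_self hs)) (norm_nonneg _)
  rw [hform, ← Complex.ofReal_mul, ← Complex.ofReal_sub, Complex.norm_real] at hnorm
  have hlower := (neg_le_abs _).trans hnorm
  have hfrac : Q * ((Q + 1)⁻¹ * A) ≤ A := by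
    rw [← mul_assoc, ← div_eq_mul_inv]
    exact mul_le_of_le_one_left hA0 ((div_le_one (by linarith)).2 (by linarith))
  nlinarith

/-- Integration by parts twice; the boundary terms cancel because `|e^{it}| = 1`. -/
theorem inner_fibreGraph {t : ℝ} {u F v G : L2Unit} (hu : (u, F) ∈ fibreGraph q t)
    (hv : (v, G) ∈ fibreGraph (fun x => starRingEnd ℂ (q x)) t) :
    inner ℂ G u = inner ℂ v F := by
  obtain ⟨f, f₁, f₂, hf, hf1, hf₁1, hfu, hfF⟩ := hu
  obtain ⟨g, g₁, g₂, hg, hg1, hg₁1, hgv, hgG⟩ := hv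
  have hp := (((hf.isPrimitiveOn zero_le_one).mul zero_le_one hg.isPrimitiveOn_deriv.conj).sub
    (hf.isPrimitiveOn_deriv.mul zero_le_one (hg.isPrimitiveOn zero_le_one).conj)).integral_eq_sub
      (left_mem_Icc.2 zero_le_one) (right_mem_Icc.2 zero_le_one)
  have hboundary : f 1 * starRingEnd ℂ (g₁ 1) - f₁ 1 * starRingEnd ℂ (g 1)
      - (f 0 * starRingEnd ℂ (g₁ 0) - f₁ 0 * starRingEnd ℂ (g 0)) = 0 := by
    rw [hf1, hf₁1, hg1, hg₁1, map_mul, map_mul]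
    linear_combination
      (f 0 * starRingEnd ℂ (g₁ 0) - f₁ 0 * starRingEnd ℂ (g 0)) * exp_mul_conj t
  rw [hboundary, intervalIntegral.integral_of_le zero_le_one] at hp
  rw [← sub_eq_zero, L2.inner_def, L2.inner_def,
    ← integral_sub (L2.integrable_inner G u) (L2.integrable_inner v F), ← neg_eq_zero,
    ← integral_neg, ← hp]
  refine integral_congr_ae ?_
  filter_upwards [hfu, hfF, hgv, hgG] with x hux hFx hvx hGx
  simp only [RCLike.inner_apply] at hux hFx hvx hGx ⊢
  rw [hux, hFx, hvx, hGx]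
  simp only [map_add, map_neg, map_mul, Complex.conj_conj]
  ring

include hq in
theorem intervalIntegrable_conj : IntervalIntegrable (fun x => starRingEnd ℂ (q x)) volume 0 1 :=
  (IsPrimitiveOn.of_integral hq 0).conj.integrable

include hq in
/-- If `g` is orthogonal to the domain and `x` is a real resolvent point of `H_t` for `q` and for
its conjugate, then the solution `v` of `(H_t* - x) v = g` is orthogonal to the range of
`H_t - x`, hence zero. -/
theorem dense_domain_fibreOp (t : ℝ) : Dense ((fibreOp q t).domain : Set L2Unit) := by
  have hq' := intervalIntegrable_conj hq
  set Q : ℝ := ∫ s in (0 : ℝ)..1, ‖q s‖ with hQ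
  have hQ' : ∫ s in (0 : ℝ)..1, ‖starRingEnd ℂ (q s)‖ = Q := by simp only [RCLike.norm_conj, hQ]
  obtain ⟨x, hx⟩ := exists_lt (-(Q * (2 + Q)))
  obtain ⟨hgraph, -⟩ := UnboundedOp.isResolvent_iff.1
    (isResolvent_fibreResolvent hq (discriminant_ne_of_lt hq hx t))
  obtain ⟨hgraph', -⟩ := UnboundedOp.isResolvent_iff.1 (isResolvent_fibreResolvent hq'
    (discriminant_ne_of_lt hq' (x := x) (by rwa [hQ']) t))
  rw [Submodule.dense_iff_topologicalClosure_eq_top, Submodule.topologicalClosure_eq_top_iff,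
    Submodule.eq_bot_iff]
  intro g hg
  have hvg := hgraph' g
  set v := fibreResolvent hq' t x g
  rw [fibreOp_graph] at hvg
  have hv0 : v = 0 := by
    refine ext_inner_right ℂ fun f => ?_
    have hperp : inner ℂ g (fibreResolvent hq t x f) = 0 :=
      Submodule.inner_left_of_mem_orthogonal (LinearPMap.mem_domain_of_mem_graph (hgraph f)) hg
    have h := inner_fibreGraph (fibreOp_graph q t ▸ hgraph f) hvg
    rw [inner_add_left, inner_add_right, inner_smul_left, inner_smul_right, hperp,
      Complex.conj_ofReal, zero_add] at h
    rw [inner_zero_left]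
    linear_combination -h
  have hzero := LinearPMap.graph_fst_eq_zero_snd _ (fibreOp_graph _ t ▸ hvg) hv0
  rwa [hv0, smul_zero, add_zero] at hzero

end Density

/-! ### A lower bound for the pairing of normalized eigenfunctions -/

section Pairing

open Matrix

variable {q : ℝ → ℂ} (hq : IntervalIntegrable q volume 0 1)

theorem continuous_endSource : Continuous (endSource hq) :=
  continuous_iff_continuousAt.2 fun z =>
    (hasDerivAt_comp_solver_comp hq endpoint source z).continuousAt

theorem continuous_solL2 : Continuous (solL2 hq) :=
  continuous_iff_continuousAt.2 fun z =>
    (hasDerivAt_comp_solver_comp hq (toL2.comp (component 0)) constCurve z).continuousAt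

theorem continuous_floquetMatrix :
    Continuous fun p : ℝ × ℂ => floquetMatrix hq p.1 p.2 := by
  have hM : Continuous (monodromy hq) := continuous_matrix fun i j =>
    continuous_iff_continuousAt.2 fun z => (hasDerivAt_monodromy_apply hq z i j).continuousAt
  exact (hM.comp continuous_snd).sub
    ((show Continuous fun p : ℝ × ℂ => Complex.exp (Complex.I * p.1) by fun_prop).smul
      continuous_const)

theorem continuous_adjugateSource :
    Continuous fun p : ℝ × ℂ => adjugateSource hq p.1 p.2 :=
  ((LinearMap.continuous_of_finiteDimensional mulVecCLM).comp
    (continuous_floquetMatrix hq).matrix_adjugate).clm_comp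
      ((continuous_endSource hq).comp continuous_snd)

/-- A locally bounded majorant of `|F'(z)| / |α|`, where `F` is the discriminant and `α` is the
pairing of normalized eigenfunctions of `H_t` and `H_t*`. -/
noncomputable def pairingBound (t : ℝ) (z : ℂ) : ℝ :=
  ‖adjugateSource hq t z‖ * ‖solL2 hq z‖

theorem continuous_pairingBound : Continuous fun p : ℝ × ℂ => pairingBound hq p.1 p.2 :=
  (continuous_adjugateSource hq).norm.mul ((continuous_solL2 hq).comp continuous_snd).norm

theorem exists_adjugateSource_eq_smul {t : ℝ} {z : ℂ} {a : Fin 2 → ℂ}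
    (hd : deriv (discriminant hq) z ≠ 0) (ha0 : a ≠ 0) (ha : floquetMatrix hq t z *ᵥ a = 0)
    (h : L2Unit) : ∃ k : ℂ, adjugateSource hq t z h = k • a := by
  refine exists_eq_smul_of_mulVec_eq_zero (floquetMatrix_ne_zero hq hd) ha0 ha ?_
  rw [adjugateSource_apply, mulVec_mulVec, mul_adjugate,
    exists_mulVec_eq_zero_iff.1 ⟨a, ha0, ha⟩, zero_smul, zero_mulVec]

theorem exists_mem_fibreGraph_of_adjugateSource_eq_zero {t : ℝ} {z : ℂ} {h : L2Unit}
    (hd : deriv (discriminant hq) z ≠ 0) (hh : adjugateSource hq t z h = 0) :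
    ∃ y, (y, h + z • y) ∈ fibreGraph q t := by
  obtain ⟨b, hb⟩ := exists_mulVec_eq_of_adjugate_mulVec_eq_zero (floquetMatrix_ne_zero hq hd)
    (v := -endSource hq z h) (by rw [mulVec_neg, ← adjugateSource_apply, hh, neg_zero])
  exact ⟨_, (mem_fibreGraph_iff hq t z _ h).2 ⟨b, rfl, hb⟩⟩

include hq in
theorem inner_adjoint_eigenvector_eq_zero {t : ℝ} {z : ℂ} {v y h : L2Unit}
    (hv : (v, starRingEnd ℂ z • v) ∈ (fibreOp q t).adjoint.graph)
    (hy : (y, h + z • y) ∈ fibreGraph q t) : inner ℂ v h = 0 := by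
  rw [← fibreOp_graph, LinearPMap.mem_graph_iff] at hy
  rw [LinearPMap.mem_graph_iff] at hv
  obtain ⟨y', rfl, hyh⟩ := hy
  obtain ⟨v', rfl, hvz⟩ := hv
  have hadj := (LinearPMap.adjoint_isFormalAdjoint (dense_domain_fibreOp hq t)) v' y'
  rw [hyh, hvz, inner_smul_left, inner_add_right, inner_smul_right, Complex.conj_conj] at hadj
  linear_combination -hadj

theorem exists_adjugateSource_eq_smul_and_norm_deriv_eq {t : ℝ} {z : ℂ} {a : Fin 2 → ℂ}
    {v : L2Unit} (hd : deriv (discriminant hq) z ≠ 0) (ha0 : a ≠ 0)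
    (ha : floquetMatrix hq t z *ᵥ a = 0) (hv1 : ‖v‖ = 1)
    (hv : (v, starRingEnd ℂ z • v) ∈ (fibreOp q t).adjoint.graph) :
    ∃ k : ℂ, adjugateSource hq t z v = k • a ∧
      ‖deriv (discriminant hq) z‖ = ‖k‖ * ‖inner ℂ v (solL2 hq z a)‖ := by
  obtain ⟨k, hk⟩ := exists_adjugateSource_eq_smul hq hd ha0 ha v
  refine ⟨k, hk, ?_⟩
  set w := -Complex.exp (Complex.I * t) * deriv (discriminant hq) z with hw
  obtain ⟨y, hy⟩ := exists_mem_fibreGraph_of_adjugateSource_eq_zero hq (t := t) hd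
    (h := w • v - k • solL2 hq z a) (by
      rw [map_sub, map_smul, map_smul, hk, adjugateSource_solL2 hq ha, smul_comm, sub_self])
  have hperp := inner_adjoint_eigenvector_eq_zero hq hv hy
  rw [inner_sub_right, inner_smul_right, inner_smul_right, inner_self_eq_norm_sq_to_K, hv1,
    RCLike.ofReal_one, one_pow, mul_one, sub_eq_zero] at hperp
  rw [← norm_mul, ← hperp, hw, norm_mul, norm_neg, mul_comm Complex.I,
    Complex.norm_exp_ofReal_mul_I, one_mul]

theorem norm_deriv_discriminant_le {t : ℝ} {z : ℂ} {u v : L2Unit}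
    (hu : UnboundedOp.IsNormalizedEigenvector (fibreOp q t) z u)
    (hv : UnboundedOp.IsNormalizedEigenvector (fibreOp q t).adjoint (starRingEnd ℂ z) v) :
    ‖deriv (discriminant hq) z‖ ≤ pairingBound hq t z * ‖inner ℂ v u‖ := by
  obtain ⟨hu1, hu⟩ := UnboundedOp.isNormalizedEigenvector_iff.1 hu
  obtain ⟨hv1, hv⟩ := UnboundedOp.isNormalizedEigenvector_iff.1 hv
  rcases eq_or_ne (deriv (discriminant hq) z) 0 with hd | hd
  · rw [hd, norm_zero]
    exact mul_nonneg (mul_nonneg (norm_nonneg _) (norm_nonneg _)) (norm_nonneg _)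
  rw [fibreOp_graph] at hu
  obtain ⟨a, rfl, ha⟩ := (mem_fibreGraph_smul_iff hq t z u).1 hu
  have ha0 : a ≠ 0 := by
    rintro rfl
    simp at hu1
  obtain ⟨k, hk, hnorm⟩ :=
    exists_adjugateSource_eq_smul_and_norm_deriv_eq hq hd ha0 ha hv1 hv
  rw [hnorm]
  refine mul_le_mul_of_nonneg_right ?_ (norm_nonneg _)
  calc ‖k‖ = ‖k‖ * ‖solL2 hq z a‖ := by rw [hu1, mul_one]
    _ ≤ ‖k‖ * (‖solL2 hq z‖ * ‖a‖) := by gcongr; exact (solL2 hq z).le_opNorm a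
    _ = ‖adjugateSource hq t z v‖ * ‖solL2 hq z‖ := by rw [hk, norm_smul]; ring
    _ ≤ pairingBound hq t z := by
      refine mul_le_mul_of_nonneg_right ?_ (norm_nonneg _)
      simpa [hv1] using (adjugateSource hq t z).le_opNorm v

end Pairing

/-! ### Analytic functions near a critical point -/

section Analytic

variable {f g : ℂ → ℂ} {w : ℂ}

theorem exists_eventually_eq_add_pow_mul (hf : AnalyticAt ℂ f w)
    (hne : ¬ ∀ᶠ z in 𝓝 w, f z = f w) :
    ∃ (n : ℕ) (g : ℂ → ℂ), AnalyticAt ℂ g w ∧ g w ≠ 0 ∧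
      ∀ᶠ z in 𝓝 w, f z = f w + (z - w) ^ (n + 1) * g z := by
  obtain ⟨m, g, hg, hg0, h⟩ :=
    (hf.sub (analyticAt_const (v := f w))).exists_eventuallyEq_pow_smul_nonzero_iff.2
      fun h => hne (h.mono fun z hz => sub_eq_zero.1 hz)
  obtain ⟨n, rfl⟩ : ∃ n, m = n + 1 := Nat.exists_eq_succ_of_ne_zero <| by
    rintro rfl
    exact hg0 (by simpa using h.self_of_nhds.symm)
  exact ⟨n, g, hg, hg0, h.mono fun z hz => eq_add_of_sub_eq' hz⟩

theorem eventually_deriv_eq_pow_mul {n : ℕ} (hg : AnalyticAt ℂ g w)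
    (h : ∀ᶠ z in 𝓝 w, f z = f w + (z - w) ^ (n + 1) * g z) :
    ∀ᶠ z in 𝓝 w, deriv f z = (z - w) ^ n * ((n + 1) * g z + (z - w) * deriv g z) := by
  filter_upwards [h.eventually_nhds, hg.eventually_analyticAt] with z hz hgz
  have hpow : HasDerivAt (fun z => (z - w) ^ (n + 1)) (((n + 1 : ℕ) : ℂ) * (z - w) ^ n * 1) z :=
    ((hasDerivAt_id z).sub_const w).pow (n + 1)
  rw [EventuallyEq.deriv_eq hz,
    ((hpow.fun_mul hgz.differentiableAt.hasDerivAt).const_add (f w)).deriv]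
  push_cast
  ring

theorem exists_norm_pow_le_norm_deriv {n : ℕ} (hg : AnalyticAt ℂ g w) (hg0 : g w ≠ 0)
    (h : ∀ᶠ z in 𝓝 w, f z = f w + (z - w) ^ (n + 1) * g z) :
    ∃ c > 0, ∀ᶠ z in 𝓝 w, c * ‖z - w‖ ^ n ≤ ‖deriv f z‖ := by
  have hfactor : ((n : ℂ) + 1) * g w + (w - w) * deriv g w ≠ 0 := by
    simpa [hg0] using Nat.cast_add_one_ne_zero (R := ℂ) n
  have hcont : ContinuousAt (fun z => ‖((n : ℂ) + 1) * g z + (z - w) * deriv g z‖) w := by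
    have := hg.continuousAt
    have := hg.deriv.continuousAt
    fun_prop
  refine ⟨_, half_pos (norm_pos_iff.2 hfactor), ?_⟩
  filter_upwards [eventually_deriv_eq_pow_mul hg h,
    hcont.eventually_const_lt (half_lt_self (norm_pos_iff.2 hfactor))] with z hz hlow
  rw [hz, norm_mul, norm_pow, mul_comm]
  gcongr

/-- If `f - f w` vanishes to order `n + 1`, then `p = n / (n + 1)`. -/
theorem exists_rpow_norm_sub_le_norm_deriv (hf : AnalyticAt ℂ f w)
    (hne : ¬ ∀ᶠ z in 𝓝 w, f z = f w) :
    ∃ p C : ℝ, 0 ≤ p ∧ p < 1 ∧ 0 < C ∧ ∀ᶠ z in 𝓝 w, ‖f z - f w‖ ^ p ≤ C * ‖deriv f z‖ := by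
  obtain ⟨n, g, hg, hg0, h⟩ := exists_eventually_eq_add_pow_mul hf hne
  obtain ⟨c, hc, hlow⟩ := exists_norm_pow_le_norm_deriv hg hg0 h
  have hup : ∀ᶠ z in 𝓝 w, ‖g z‖ < ‖g w‖ + 1 :=
    hg.continuousAt.norm.eventually_lt_const (lt_add_one _)
  set p : ℝ := n / (n + 1 : ℝ) with hp
  refine ⟨p, (‖g w‖ + 1) ^ p / c, by positivity, ?_, by positivity, ?_⟩
  · rw [hp, div_lt_one (by positivity)]
    exact lt_add_one _
  filter_upwards [h, hlow, hup] with z hfz hdz hgz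
  have hpow : (‖z - w‖ ^ (n + 1)) ^ p = ‖z - w‖ ^ n := by
    rw [← Real.rpow_natCast, ← Real.rpow_mul (norm_nonneg _), ← Real.rpow_natCast]
    congr 1
    rw [hp]
    push_cast
    field_simp
  calc ‖f z - f w‖ ^ p = (‖z - w‖ ^ (n + 1) * ‖g z‖) ^ p := by
        rw [hfz, add_sub_cancel_left, norm_mul, norm_pow]
    _ ≤ (‖z - w‖ ^ (n + 1) * (‖g w‖ + 1)) ^ p := by gcongr
    _ = (‖g w‖ + 1) ^ p / c * (c * ‖z - w‖ ^ n) := by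
        rw [Real.mul_rpow (by positivity) (by positivity), hpow]
        field_simp
    _ ≤ (‖g w‖ + 1) ^ p / c * ‖deriv f z‖ := by gcongr

theorem exists_analyticAt_pow_eq {m : ℕ} (hm : m ≠ 0) (hg : AnalyticAt ℂ g w) (hg0 : g w ≠ 0) :
    ∃ k : ℂ → ℂ, AnalyticAt ℂ k w ∧ ∀ z, k z ^ m = g z := by
  obtain ⟨c, hc⟩ := IsAlgClosed.exists_pow_nat_eq (g w) (Nat.pos_of_ne_zero hm)
  refine ⟨fun z => c * (g z / g w) ^ ((m : ℂ)⁻¹), analyticAt_const.mul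
    ((hg.div analyticAt_const hg0).cpow analyticAt_const ?_), fun z => ?_⟩
  · rw [Pi.div_apply, div_self hg0]
    exact Complex.one_mem_slitPlane
  · rw [mul_pow, Complex.cpow_nat_inv_pow _ hm, hc, mul_div_cancel₀ _ hg0]

theorem exists_local_coordinate (hf : AnalyticAt ℂ f w) (hne : ¬ ∀ᶠ z in 𝓝 w, f z = f w)
    (hd : deriv f w = 0) :
    ∃ (m : ℕ) (k : ℂ → ℂ), 1 < m ∧ 𝓝 0 ≤ map k (𝓝 w) ∧ ∀ᶠ z in 𝓝 w, f z = f w + k z ^ m := by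
  obtain ⟨n, g, hg, hg0, h⟩ := exists_eventually_eq_add_pow_mul hf hne
  have hn : n ≠ 0 := by
    rintro rfl
    have := (eventually_deriv_eq_pow_mul hg h).self_of_nhds
    exact hg0 (by simpa [hd] using this.symm)
  obtain ⟨r, hr, hrg⟩ := exists_analyticAt_pow_eq n.succ_ne_zero hg hg0
  have hr0 : r w ≠ 0 := fun h0 => hg0 (by rw [← hrg, h0, zero_pow n.succ_ne_zero])
  set k : ℂ → ℂ := fun z => (z - w) * r z with hk
  have hkd : HasDerivAt k (r w) w := by
    simpa using ((hasDerivAt_id w).sub_const w).fun_mul hr.differentiableAt.hasDerivAt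
  have hka : AnalyticAt ℂ k w := (analyticAt_id.sub analyticAt_const).mul hr
  refine ⟨n + 1, k, by lia, ?_, h.mono fun z hz => by rw [hz, hk, mul_pow, hrg]⟩
  have hopen := hka.eventually_constant_or_nhds_le_map_nhds.resolve_left fun hconst =>
    hr0 (hkd.unique ((hasDerivAt_const w (k w)).congr_of_eventuallyEq hconst))
  simpa [hk] using hopen

/-- In a coordinate `k` with `f = f w + k ^ m`, `m ≥ 2`, the value `f w + ζ ^ m` is taken where
`k = ζ` and where `k = ω ζ`, `ω` being a primitive `m`-th root of unity. -/
theorem eventually_exists_two_preimages (hf : AnalyticAt ℂ f w)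
    (hne : ¬ ∀ᶠ z in 𝓝 w, f z = f w) (hd : deriv f w = 0) {U : Set ℂ} (hU : U ∈ 𝓝 w) :
    ∀ᶠ v in 𝓝[≠] (f w), ∃ z₁ ∈ U, ∃ z₂ ∈ U, z₁ ≠ z₂ ∧ f z₁ = v ∧ f z₂ = v := by
  obtain ⟨m, k, hm, hopen, h⟩ := exists_local_coordinate hf hne hd
  have hm0 : 0 < m := zero_lt_one.trans hm
  obtain ⟨ρ, hρ, hball⟩ := Metric.mem_nhds_iff.1 (hopen (image_mem_map (inter_mem hU h)))
  filter_upwards [mem_nhdsWithin_of_mem_nhds (Metric.ball_mem_nhds (f w) (pow_pos hρ m)),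
    self_mem_nhdsWithin] with v hv hvne
  have hpreimage : ∀ ξ : ℂ, ξ ^ m = v - f w → ∃ z ∈ U, k z = ξ ∧ f z = v := fun ξ hξ => by
    have hξρ : ‖ξ‖ < ρ := by
      rw [mem_ball_iff_norm, ← hξ, norm_pow] at hv
      exact lt_of_pow_lt_pow_left₀ m hρ.le hv
    obtain ⟨z, ⟨hzU, hz⟩, hkz⟩ := hball (mem_ball_zero_iff.2 hξρ)
    exact ⟨z, hzU, hkz, by rw [hz, hkz, hξ, add_sub_cancel]⟩
  obtain ⟨ζ, hζ⟩ := IsAlgClosed.exists_pow_nat_eq (v - f w) hm0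
  have hζ0 : ζ ≠ 0 := by
    rintro rfl
    rw [zero_pow hm0.ne'] at hζ
    exact hvne (sub_eq_zero.1 hζ.symm)
  have hω := Complex.isPrimitiveRoot_exp m hm0.ne'
  set ω := Complex.exp (2 * Real.pi * Complex.I / m)
  obtain ⟨z₁, hz₁, hk₁, hf₁⟩ := hpreimage ζ hζ
  obtain ⟨z₂, hz₂, hk₂, hf₂⟩ := hpreimage (ω * ζ) (by rw [mul_pow, hω.pow_eq_one, one_mul, hζ])
  refine ⟨z₁, hz₁, z₂, hz₂, ?_, hf₁, hf₂⟩
  rintro rfl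
  exact hω.ne_one hm (mul_right_cancel₀ hζ0 (by rw [one_mul, ← hk₂, hk₁]))

end Analytic

/-! ### Unbounded spectral projections -/

theorem hasDerivAt_two_mul_cos (t : ℝ) :
    HasDerivAt (fun t : ℝ => (2 * Real.cos t : ℂ)) (-(2 * Real.sin t : ℂ)) t := by
  simpa using (Real.hasDerivAt_cos t).ofReal_comp.const_mul (2 : ℂ)

section Projections

open Matrix

variable {q : ℝ → ℂ} (hq : IntervalIntegrable q volume 0 1)

theorem not_eventually_discriminant_eq {w : ℂ} {t : ℝ} (hw : discriminant hq w = 2 * Real.cos t) :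
    ¬ ∀ᶠ z in 𝓝 w, discriminant hq z = discriminant hq w := by
  intro h
  have hF : AnalyticOnNhd ℂ (discriminant hq) univ := fun z _ =>
    (differentiable_discriminant hq).analyticAt z
  have hconst := hF.eq_of_eventuallyEq (fun _ _ => analyticAt_const) h
  obtain ⟨x, hx⟩ := exists_lt (-((∫ x in 0..1, ‖q x‖) * (2 + ∫ x in 0..1, ‖q x‖)))
  exact discriminant_ne_of_lt hq hx t (by rw [hconst, hw])

theorem eventually_exists_two_eigenvalues {w : ℂ} {t : ℝ}
    (hw : discriminant hq w = 2 * Real.cos t) (hd : deriv (discriminant hq) w = 0)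
    (ht : Real.sin t ≠ 0) {U : Set ℂ} (hU : U ∈ 𝓝 w) :
    ∀ᶠ s : ℝ in 𝓝[≠] t, ∃ z₁ ∈ U, ∃ z₂ ∈ U, z₁ ≠ z₂ ∧ discriminant hq z₁ = 2 * Real.cos s ∧
      discriminant hq z₂ = 2 * Real.cos s ∧ deriv (discriminant hq) z₁ ≠ 0 := by
  have hF : AnalyticAt ℂ (discriminant hq) w := (differentiable_discriminant hq).analyticAt w
  have hne := not_eventually_discriminant_eq hq hw
  have hcos_ne : ∀ᶠ s : ℝ in 𝓝[≠] t, (2 * Real.cos s : ℂ) ≠ discriminant hq w :=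
    hw ▸ (hasDerivAt_two_mul_cos t).eventually_ne
      (neg_ne_zero.2 (mul_ne_zero two_ne_zero (Complex.ofReal_ne_zero.2 ht)))
  have hcos : Tendsto (fun s : ℝ => (2 * Real.cos s : ℂ)) (𝓝[≠] t) (𝓝[≠] discriminant hq w) :=
    tendsto_nhdsWithin_iff.2 ⟨hw ▸ (hasDerivAt_two_mul_cos t).continuousAt.tendsto.mono_left
      nhdsWithin_le_nhds, hcos_ne⟩
  obtain ⟨p, C, -, -, -, hbound⟩ := exists_rpow_norm_sub_le_norm_deriv hF hne
  filter_upwards [hcos_ne, hcos.eventually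
    (eventually_exists_two_preimages hF hne hd (inter_mem hU hbound))] with s hs hpre
  obtain ⟨z₁, ⟨hz₁, hle⟩, z₂, ⟨hz₂, -⟩, hz, hF₁, hF₂⟩ := hpre
  refine ⟨z₁, hz₁, z₂, hz₂, hz, hF₁, hF₂, fun h0 => ?_⟩
  have hpos : 0 < ‖discriminant hq z₁ - discriminant hq w‖ ^ p :=
    Real.rpow_pos_of_pos (norm_pos_iff.2 (sub_ne_zero.2 (hF₁ ▸ hs))) p
  rw [mem_ofPred_eq, h0, norm_zero, mul_zero] at hle
  exact hpos.not_ge hle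

/-- The eigenfunction of `H_t` for the eigenvalue `z` with initial values `adj (M(z) - e^{it}) c`,
for `p = (t, z)` with `F(z) = 2 cos t`; it depends continuously on `p`. -/
noncomputable def blochVector (c : Fin 2 → ℂ) (p : ℝ × ℂ) : L2Unit :=
  solL2 hq p.2 ((floquetMatrix hq p.1 p.2).adjugate *ᵥ c)

theorem continuous_blochVector (c : Fin 2 → ℂ) : Continuous (blochVector hq c) :=
  ((continuous_solL2 hq).comp continuous_snd).clm_apply
    ((continuous_floquetMatrix hq).matrix_adjugate.matrix_mulVec continuous_const)

theorem blochVector_mem_fibreGraph (c : Fin 2 → ℂ) {t : ℝ} {z : ℂ}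
    (hz : discriminant hq z = 2 * Real.cos t) :
    (blochVector hq c (t, z), z • blochVector hq c (t, z)) ∈ fibreGraph q t := by
  refine (mem_fibreGraph_smul_iff hq t z _).2 ⟨_, rfl, ?_⟩
  rw [mulVec_mulVec, mul_adjugate, (det_floquetMatrix_eq_zero_iff hq).2 hz, zero_smul, zero_mulVec]

theorem floquetMatrix_ne_zero_of_sin_ne_zero {t : ℝ} (ht : Real.sin t ≠ 0) {z : ℂ}
    (hz : discriminant hq z = 2 * Real.cos t) : floquetMatrix hq t z ≠ 0 := by
  intro h
  rw [discriminant, sub_eq_zero.1 h, trace_smul, trace_one, mul_comm Complex.I] at hz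
  have him := congrArg Complex.im hz
  refine ht (mul_left_cancel₀ two_ne_zero ?_ : Real.sin t = 0)
  simpa [Complex.exp_im] using him.symm

theorem exists_blochVector_ne_zero {t : ℝ} {z : ℂ} (hz : discriminant hq z = 2 * Real.cos t)
    (ht : Real.sin t ≠ 0) : ∃ c, blochVector hq c (t, z) ≠ 0 := by
  by_contra! h
  have hadj : (floquetMatrix hq t z).adjugate = 0 := ext_of_mulVec_single fun i => by
    rw [(solL2_eq_zero_iff hq).1 (h (Pi.single i 1)), zero_mulVec]
  refine floquetMatrix_ne_zero_of_sin_ne_zero hq ht hz ?_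
  simpa [hadj, eq_comm] using adjugate_adjugate (floquetMatrix hq t z) (by simp)

theorem exists_isSpectralProjection_fibreOp (t : ℝ) {z : ℂ}
    (hd : deriv (discriminant hq) z ≠ 0) :
    ∃ P, UnboundedOp.IsSpectralProjection (fibreOp q t) z P :=
  UnboundedOp.exists_isSpectralProjection <|
    ((differentiable_discriminant hq z).hasDerivAt.eventually_ne
      (c := (2 * Real.cos t : ℂ)) hd).mono fun _ h => ⟨_, isResolvent_fibreResolvent hq h⟩

theorem not_bounded_projections {w : ℂ} {t : ℝ} (ht : t ∈ Ioo (0 : ℝ) (2 * Real.pi))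
    (hw : discriminant hq w = 2 * Real.cos t) (hd : deriv (discriminant hq) w = 0)
    (hs : Real.sin t ≠ 0) {ε : ℝ} (hε : 0 < ε) :
    ¬ ∃ C : ℝ, ∀ t ∈ Ico (0 : ℝ) (2 * Real.pi), ∀ z ∈ Metric.ball w ε,
      UnboundedOp.IsSimpleEigenvalue (fibreOp q t) z →
        ∀ P : L2Unit →L[ℂ] L2Unit, UnboundedOp.IsSpectralProjection (fibreOp q t) z P →
          ‖P‖ ≤ C := by
  rintro ⟨C, hC⟩
  obtain ⟨c, hc⟩ := exists_blochVector_ne_zero hq hw hs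
  set ψ := blochVector hq c
  have hψc : Continuous ψ := continuous_blochVector hq c
  have hclose : ∀ᶠ p : ℝ × ℂ × ℂ in 𝓝 (t, w, w),
      C * ‖ψ (p.1, p.2.1) - ψ (p.1, p.2.2)‖ < ‖ψ (p.1, p.2.1)‖ := by
    refine ContinuousAt.eventually_lt (by fun_prop) (by fun_prop) ?_
    simpa using hc
  rw [nhds_prod_eq, nhds_prod_eq, eventually_prod_iff] at hclose
  obtain ⟨V, hV, W, hW, hclose⟩ := hclose
  obtain ⟨U, hU, hUW⟩ := eventually_prod_self_iff'.1 hW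
  obtain ⟨s, ⟨z₁, ⟨hz₁U, hz₁ε⟩, z₂, ⟨hz₂U, -⟩, hz, hF₁, hF₂, hd₁⟩, hVs, hs⟩ :=
    ((eventually_exists_two_eigenvalues hq hw hd hs
      (inter_mem hU (Metric.ball_mem_nhds w hε))).and (mem_nhdsWithin_of_mem_nhds
        (inter_mem hV (Ioo_mem_nhds ht.1 ht.2)))).exists
  obtain ⟨P, hP⟩ := exists_isSpectralProjection_fibreOp hq s hd₁
  have hPC : ‖P‖ ≤ C := hC s (Ioo_subset_Ico_self hs) z₁ hz₁ε
    (isSimpleEigenvalue_of_deriv_ne_zero hq hF₁ hd₁) P hP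
  refine (hclose hVs (hUW _ hz₁U _ hz₂U)).not_ge ?_
  calc ‖ψ (s, z₁)‖ ≤ ‖P‖ * ‖ψ (s, z₁) - ψ (s, z₂)‖ := hP.norm_le_mul_norm_sub
        ((fibreOp_graph q s).symm ▸ blochVector_mem_fibreGraph hq c hF₁)
        ((fibreOp_graph q s).symm ▸ blochVector_mem_fibreGraph hq c hF₂) hz.symm
    _ ≤ C * ‖ψ (s, z₁) - ψ (s, z₂)‖ := by gcongr

end Projections

/-! ### Integrability of the reciprocal pairing -/

theorem eventually_mul_dist_le_norm_sub {E : Type*} [NormedAddCommGroup E] [NormedSpace ℝ E]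
    {f : ℝ → E} {f' : E} {s c : ℝ} (hf : HasDerivAt f f' s) (hc : c < ‖f'‖) :
    ∀ᶠ t in 𝓝[≠] s, c * |t - s| ≤ ‖f t - f s‖ := by
  filter_upwards [(hasDerivAt_iff_tendsto_slope.1 hf).norm.eventually_const_lt hc,
    self_mem_nhdsWithin] with t ht hts
  rw [slope_def_module, norm_smul, norm_inv, Real.norm_eq_abs, inv_mul_eq_div,
    lt_div_iff₀ (abs_pos.2 (sub_ne_zero.2 hts))] at ht
  exact ht.le

theorem measurableSet_puncturedNhd (s δ : ℝ) : MeasurableSet (puncturedNhd s δ) :=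
  measurableSet_Ioo.union measurableSet_Ioo

theorem puncturedNhd_eq {s η : ℝ} (hη : 0 < η) : puncturedNhd s η = Metric.ball s η \ {s} := by
  ext t
  simp only [puncturedNhd, Real.ball_eq_Ioo, mem_union, Set.mem_sdiff, mem_Ioo, mem_singleton_iff]
  grind

theorem puncturedNhd_mem_nhdsNE {s η : ℝ} (hη : 0 < η) : puncturedNhd s η ∈ 𝓝[≠] s := by
  rw [puncturedNhd_eq hη]
  exact sdiff_mem_nhdsWithin_compl (Metric.ball_mem_nhds s hη) {s}

theorem integrableOn_rpow_abs_sub {s η p : ℝ} (hη : 0 < η) (hp : p < 1) :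
    IntegrableOn (fun t : ℝ => |t - s| ^ (-p)) (puncturedNhd s η) := by
  have hpow : IntervalIntegrable (fun x : ℝ => x ^ (-p)) volume 0 η :=
    intervalIntegral.intervalIntegrable_rpow' (by linarith)
  have hleft : IntervalIntegrable (fun t : ℝ => (s - t) ^ (-p)) volume (s - η) s := by
    simpa using (hpow.comp_sub_left s).symm
  have hright : IntervalIntegrable (fun t : ℝ => (t - s) ^ (-p)) volume s (s + η) := by
    simpa [add_comm] using hpow.comp_sub_right s
  rw [intervalIntegrable_iff_integrableOn_Ioo_of_le (by linarith)] at hleft hright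
  refine (hleft.congr_fun (fun t ht => ?_) measurableSet_Ioo).union
    (hright.congr_fun (fun t ht => ?_) measurableSet_Ioo)
  · simp only [abs_sub_comm t s, abs_of_pos (sub_pos.2 ht.2)]
  · simp only [abs_of_pos (sub_pos.2 ht.1)]

theorem exists_lintegral_inv_enorm_lt_top {f : ℝ → ℂ} {s p c δ : ℝ} (hδ : 0 < δ) (hp : p < 1)
    (hc : 0 < c) (h : ∀ᶠ t in 𝓝[≠] s, c * |t - s| ^ p ≤ ‖f t‖) :
    ∃ η ∈ Ioc 0 δ, ∫⁻ t in puncturedNhd s η, ‖f t‖ₑ⁻¹ < ⊤ := by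
  obtain ⟨ε, hε, hball⟩ := Metric.eventually_nhds_iff_ball.1 (eventually_nhdsWithin_iff.1 h)
  have hη : 0 < min ε δ := lt_min hε hδ
  refine ⟨min ε δ, ⟨hη, min_le_right _ _⟩, lt_of_le_of_lt (setLIntegral_mono'
    (measurableSet_puncturedNhd s _) fun t ht => ?_)
    ((integrableOn_rpow_abs_sub hη hp).const_mul c⁻¹).lintegral_lt_top⟩
  rw [puncturedNhd_eq hη] at ht
  have hle := hball t (Metric.ball_subset_ball (min_le_left _ _) ht.1) ht.2
  have hpos : 0 < c * |t - s| ^ p :=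
    mul_pos hc (Real.rpow_pos_of_pos (abs_pos.2 (sub_ne_zero.2 ht.2)) p)
  rw [← ofReal_norm, ← ENNReal.ofReal_inv_of_pos (hpos.trans_le hle),
    Real.rpow_neg (abs_nonneg _), ← mul_inv]
  exact ENNReal.ofReal_le_ofReal (inv_anti₀ hpos hle)

section Pairing

variable {q : ℝ → ℂ} (hq : IntervalIntegrable q volume 0 1)

include hq in
theorem IsSimpleBranch.exists_rpow_le_norm_inner {w : ℂ} {s δ : ℝ} (hδ : 0 < δ)
    (hw : discriminant hq w = 2 * Real.cos s) (hs : Real.sin s ≠ 0) {ev : ℝ → ℂ}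
    {Ψ Ψs : ℝ → L2Unit} (hbr : IsSimpleBranch q s δ ev Ψ Ψs) (hev : Tendsto ev (𝓝[≠] s) (𝓝 w)) :
    ∃ p c : ℝ, p < 1 ∧ 0 < c ∧ ∀ᶠ t in 𝓝[≠] s, c * |t - s| ^ p ≤ ‖inner ℂ (Ψs t) (Ψ t)‖ := by
  obtain ⟨p, C, hp0, hp1, hC, hbound⟩ := exists_rpow_norm_sub_le_norm_deriv
    ((differentiable_discriminant hq).analyticAt w) (not_eventually_discriminant_eq hq hw)
  have hsin : |Real.sin s| < ‖-(2 * Real.sin s : ℂ)‖ := by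
    rw [norm_neg, norm_mul, Complex.norm_real, Real.norm_eq_abs, Complex.norm_ofNat]
    linarith [abs_pos.2 hs]
  obtain ⟨B, hB⟩ := exists_gt (pairingBound hq s w)
  have hB0 : 0 < B := (mul_nonneg (norm_nonneg _) (norm_nonneg _)).trans_lt hB
  have hpair : ∀ᶠ t in 𝓝[≠] s, pairingBound hq t (ev t) < B :=
    (((continuous_pairingBound hq).tendsto (s, w)).comp
      ((tendsto_nhdsWithin_of_tendsto_nhds tendsto_id).prodMk_nhds hev)).eventually_lt_const hB
  refine ⟨p, |Real.sin s| ^ p / (C * B), hp1,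
    div_pos (Real.rpow_pos_of_pos (abs_pos.2 hs) p) (mul_pos hC hB0), ?_⟩
  filter_upwards [hev.eventually hbound, hpair, puncturedNhd_mem_nhdsNE hδ,
    eventually_mul_dist_le_norm_sub (hasDerivAt_two_mul_cos s) hsin] with t hF hBt ht hcos
  have hFt : discriminant hq (ev t) = 2 * Real.cos t := by
    obtain ⟨hn, hg⟩ := UnboundedOp.isNormalizedEigenvector_iff.1 (hbr.eigen t ht)
    exact discriminant_eq_of_mem_spectrum hq (UnboundedOp.mem_spectrum_of_mem_graph
      (norm_ne_zero_iff.1 (by rw [hn]; exact one_ne_zero)) hg)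
  rw [hFt, hw] at hF
  rw [div_mul_eq_mul_div, div_le_iff₀ (mul_pos hC hB0)]
  calc |Real.sin s| ^ p * |t - s| ^ p = (|Real.sin s| * |t - s|) ^ p :=
        (Real.mul_rpow (abs_nonneg _) (abs_nonneg _)).symm
    _ ≤ ‖(2 * Real.cos t : ℂ) - 2 * Real.cos s‖ ^ p := by gcongr
    _ ≤ C * ‖deriv (discriminant hq) (ev t)‖ := hF
    _ ≤ C * (pairingBound hq t (ev t) * ‖inner ℂ (Ψs t) (Ψ t)‖) := by
        gcongr
        exact norm_deriv_discriminant_le hq (hbr.eigen t ht) (hbr.adjoint_eigen t ht)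
    _ ≤ C * (B * ‖inner ℂ (Ψs t) (Ψ t)‖) := by gcongr
    _ = ‖inner ℂ (Ψs t) (Ψ t)‖ * (C * B) := by ring

theorem not_isEssentialSpectralSingularity {w : ℂ} {t : ℝ}
    (hw : discriminant hq w = 2 * Real.cos t) (ht : Real.sin t ≠ 0) :
    ¬ IsEssentialSpectralSingularity q w := by
  rintro ⟨-, s, -, hws, δ, hδ, ev, Ψ, Ψs, hbr, hev, hint⟩
  have hFs := discriminant_eq_of_mem_spectrum hq hws
  have hcos : Real.cos s = Real.cos t :=
    Complex.ofReal_injective (mul_left_cancel₀ two_ne_zero (hFs.symm.trans hw))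
  have hs : Real.sin s ≠ 0 := by
    rw [← abs_pos, Real.abs_sin_eq_sqrt_one_sub_cos_sq, hcos,
      ← Real.abs_sin_eq_sqrt_one_sub_cos_sq]
    exact abs_pos.2 ht
  obtain ⟨p, c, hp, hc, hle⟩ := hbr.exists_rpow_le_norm_inner hq hδ hFs hs hev
  obtain ⟨η, hη, hlt⟩ := exists_lintegral_inv_enorm_lt_top hδ hp hc hle
  exact hlt.ne (hint η hη)

end Pairing

/-! ### Bloch waves -/

namespace IsPrimitiveOn

variable {F : Type*} [NormedAddCommGroup F] [NormedSpace ℝ F] {a b c : ℝ} {u U : ℝ → F}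

theorem trans (h₁ : IsPrimitiveOn a b u U) (h₂ : IsPrimitiveOn b c u U) (hab : a ≤ b)
    (hbc : b ≤ c) : IsPrimitiveOn a c u U := by
  refine ⟨h₁.integrable.trans h₂.integrable, fun x hx => ?_⟩
  rcases le_total x b with hxb | hxb
  · exact h₁.eq x ⟨hx.1, hxb⟩
  · rw [h₂.eq x ⟨hxb, hx.2⟩, h₁.eq b (right_mem_Icc.2 hab), add_assoc,
      intervalIntegral.integral_add_adjacent_intervals h₁.integrable
        (h₂.intervalIntegrable (left_mem_Icc.2 hbc) ⟨hxb, hx.2⟩)]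

theorem comp_sub_right (h : IsPrimitiveOn a b u U) (d : ℝ) :
    IsPrimitiveOn (a + d) (b + d) (fun x => u (x - d)) (fun x => U (x - d)) := by
  refine ⟨h.integrable.comp_sub_right d, fun x hx => ?_⟩
  rw [intervalIntegral.integral_comp_sub_right (fun x => U x), add_sub_cancel_right]
  exact h.eq (x - d) ⟨by linarith [hx.1], by linarith [hx.2]⟩

theorem of_forall_int (h : ∀ n : ℤ, IsPrimitiveOn n (n + 1) u U) (hab : a ≤ b) :
    IsPrimitiveOn a b u U := by
  have hcells : ∀ k : ℕ, IsPrimitiveOn (⌊a⌋ : ℝ) (⌊a⌋ + k) u U := fun k => by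
    induction k with
    | zero => simpa using (h ⌊a⌋).mono (d := ⌊a⌋) (by simp) (by simp)
    | succ k ih =>
      have hlast := h (⌊a⌋ + k)
      push_cast at hlast ⊢
      rw [← add_assoc]
      exact ih.trans hlast (le_add_of_nonneg_right (Nat.cast_nonneg k)) (by linarith)
  obtain ⟨k, hk⟩ := exists_nat_ge (b - ⌊a⌋)
  have hb : b ≤ ⌊a⌋ + k := by linarith
  exact (hcells k).mono ⟨Int.floor_le a, hab.trans hb⟩ ⟨(Int.floor_le a).trans hab, hb⟩

theorem continuous (h : ∀ a b : ℝ, a ≤ b → IsPrimitiveOn a b u U) : Continuous u :=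
  continuous_iff_continuousAt.2 fun x =>
    (h (x - 1) (x + 1) (by linarith)).continuousOn.continuousAt
      (Icc_mem_nhds (by linarith) (by linarith))

end IsPrimitiveOn

/-- The quasiperiodic extension with multiplier `μ` of the restriction of `u` to `[0, 1)`. -/
noncomputable def quasiExt (μ : ℂ) (u : ℝ → ℂ) (x : ℝ) : ℂ := μ ^ ⌊x⌋ * u (Int.fract x)

section QuasiExt

variable {μ : ℂ} {u U : ℝ → ℂ}

theorem quasiExt_of_mem_Ico (μ : ℂ) (u : ℝ → ℂ) (n : ℤ) {x : ℝ} (hx : x ∈ Ico (n : ℝ) (n + 1)) :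
    quasiExt μ u x = μ ^ n * u (x - n) := by
  rw [quasiExt, Int.fract, Int.floor_eq_iff.2 hx]

theorem quasiExt_of_mem_Icc (hμ : μ ≠ 0) (hu : u 1 = μ * u 0) (n : ℤ) {x : ℝ}
    (hx : x ∈ Icc (n : ℝ) (n + 1)) : quasiExt μ u x = μ ^ n * u (x - n) := by
  rcases hx.2.lt_or_eq with h | rfl
  · exact quasiExt_of_mem_Ico μ u n ⟨hx.1, h⟩
  · have hnext := quasiExt_of_mem_Ico μ u (n + 1) (x := n + 1) (by push_cast; simp)
    push_cast at hnext
    rw [hnext, sub_self, add_sub_cancel_left, hu, zpow_add_one₀ hμ, mul_assoc]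

theorem quasiExt_add_one (hμ : μ ≠ 0) (u : ℝ → ℂ) (x : ℝ) :
    quasiExt μ u (x + 1) = μ * quasiExt μ u x := by
  rw [quasiExt, quasiExt, Int.floor_add_one, Int.fract_add_one, zpow_add_one₀ hμ]
  ring

theorem isPrimitiveOn_quasiExt (hμ : μ ≠ 0) (h : IsPrimitiveOn 0 1 u U) (hu : u 1 = μ * u 0)
    {a b : ℝ} (hab : a ≤ b) : IsPrimitiveOn a b (quasiExt μ u) (quasiExt μ U) := by
  refine .of_forall_int (fun n => ?_) hab
  have hcell := (h.comp_sub_right n).const_mul (μ ^ n)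
  rw [zero_add, add_comm] at hcell
  refine hcell.congr (by linarith) (fun x hx => quasiExt_of_mem_Icc hμ hu n hx) ?_
  have hne : ∀ᵐ x : ℝ, x ≠ n + 1 := by simp [ae_iff, measure_singleton]
  filter_upwards [ae_restrict_mem measurableSet_Ioc, ae_restrict_of_ae hne] with x hx hxn
  exact quasiExt_of_mem_Ico μ U n ⟨hx.1.le, hx.2.lt_of_ne hxn⟩

end QuasiExt

/-- `f`, with derivative `f₁`, is a Bloch wave for the multiplier `μ`: a bounded quasiperiodic
solution on the whole line of `-f'' + q f = w f`. -/
structure IsBlochWave (q : ℝ → ℂ) (w μ : ℂ) (f f₁ : ℝ → ℂ) : Prop where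
  isPrimitiveOn : ∀ a b : ℝ, a ≤ b → IsPrimitiveOn a b f f₁
  isPrimitiveOn_deriv : ∀ a b : ℝ, a ≤ b → IsPrimitiveOn a b f₁ fun x => (q x - w) * f x
  norm_multiplier : ‖μ‖ = 1
  add_one : ∀ x, f (x + 1) = μ * f x
  deriv_add_one : ∀ x, f₁ (x + 1) = μ * f₁ x

theorem exists_isBlochWave {q : ℝ → ℂ} (hq : IntervalIntegrable q volume 0 1)
    (hper : Function.Periodic q 1) {w : ℂ} {t : ℝ} (hw : discriminant hq w = 2 * Real.cos t) :
    ∃ f f₁ : ℝ → ℂ, IsBlochWave q w (Complex.exp (Complex.I * t)) f f₁ ∧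
      0 < ∫ x in (0 : ℝ)..1, ‖f x‖ ^ 2 := by
  obtain ⟨c, hc0, hc⟩ :=
    Matrix.exists_mulVec_eq_zero_iff.2 ((det_floquetMatrix_eq_zero_iff hq).2 hw)
  obtain ⟨h0, h1⟩ := sol_quasiperiodic hq hc
  set μ := Complex.exp (Complex.I * t)
  have hμ : μ ≠ 0 := Complex.exp_ne_zero _
  have hderiv : IsPrimitiveOn 0 1 (extend (solDeriv hq w c 0))
      (fun s => (q s - w) * extend (sol hq w c 0) s) := by
    refine (isPrimitiveOn_solDeriv hq w c 0).congr zero_le_one (fun _ _ => rfl) ?_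
    filter_upwards [Lp.coeFn_zero ℂ 2 (volume.restrict (Ioc (0 : ℝ) 1))] with s hs
    rw [hs, Pi.zero_apply, sub_zero]
  refine ⟨quasiExt μ (extend (sol hq w c 0)), quasiExt μ (extend (solDeriv hq w c 0)),
    ⟨fun a b => isPrimitiveOn_quasiExt hμ (isPrimitiveOn_sol hq w c 0) h0, fun a b hab => ?_,
      Complex.norm_exp_I_mul_ofReal t, quasiExt_add_one hμ _,
      quasiExt_add_one hμ _⟩, ?_⟩
  · refine (isPrimitiveOn_quasiExt hμ hderiv h1 hab).congr hab (fun _ _ => rfl)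
      (ae_of_all _ fun x => ?_)
    have hqx : q (Int.fract x) = q x := by simpa using hper.sub_zsmul_eq (x := x) ⌊x⌋
    simp only [quasiExt, hqx]
    ring
  · refine (integral_norm_sq_sol_pos hq (z := w) hc0).trans_eq
      (intervalIntegral.integral_congr fun s hs => ?_)
    rw [uIcc_of_le zero_le_one] at hs
    simp [quasiExt_of_mem_Icc hμ h0 0 (x := s) (by simpa using hs)]

namespace IsBlochWave

variable {q : ℝ → ℂ} {w μ : ℂ} {f f₁ : ℝ → ℂ}

theorem continuous (h : IsBlochWave q w μ f f₁) : Continuous f :=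
  IsPrimitiveOn.continuous h.isPrimitiveOn

theorem continuous_deriv (h : IsBlochWave q w μ f f₁) : Continuous f₁ :=
  IsPrimitiveOn.continuous h.isPrimitiveOn_deriv

theorem integral_norm_sq (h : IsBlochWave q w μ f f₁) (n : ℕ) :
    ∫ x in (1 : ℝ)..1 + n, ‖f x‖ ^ 2 = n * ∫ x in (0 : ℝ)..1, ‖f x‖ ^ 2 := by
  have hc := h.continuous
  have hper : Function.Periodic (fun x => ‖f x‖ ^ 2) 1 := fun x => by
    simp only [h.add_one, norm_mul, h.norm_multiplier, one_mul]
  simpa [hper.intervalIntegral_add_eq 1 0] using hper.intervalIntegral_add_zsmul_eq n 1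
    fun _ _ => Continuous.intervalIntegrable (by fun_prop) _ _

end IsBlochWave

/-! ### The spectrum of the operator on the line -/

theorem norm_sq_toLp {α : Type*} [MeasurableSpace α] {ν : Measure α} {g : α → ℂ}
    (hg : MemLp g 2 ν) : ‖hg.toLp g‖ ^ 2 = ∫ x, ‖g x‖ ^ 2 ∂ν := by
  rw [Lp.norm_toLp, hg.eLpNorm_eq_integral_rpow_norm two_ne_zero ENNReal.ofNat_ne_top,
    ENNReal.toReal_ofReal (by positivity)]
  norm_num
  rw [← Real.sqrt_eq_rpow, Real.sq_sqrt (by positivity)]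

theorem isPrimitiveOn_of_contDiff {g : ℝ → ℝ} (hg : ContDiff ℝ 1 g) (a b : ℝ) :
    IsPrimitiveOn a b (fun x => (g x : ℂ)) (fun x => ((deriv g x : ℝ) : ℂ)) := by
  have hc : Continuous fun x => ((deriv g x : ℝ) : ℂ) :=
    Complex.continuous_ofReal.comp (hg.continuous_deriv le_rfl)
  refine ⟨hc.intervalIntegrable _ _, fun x _ => ?_⟩
  rw [intervalIntegral.integral_eq_sub_of_hasDerivAt (f := fun x => (g x : ℂ))
    (fun y _ => (hg.differentiable one_ne_zero y).hasDerivAt.ofReal_comp)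
    (hc.intervalIntegrable _ _), add_sub_cancel]

/-- The function `[-d²/dx², χ] f = -χ'' f - 2 χ' f'`, where `f₁` stands for `f'`. -/
noncomputable def commutator (χ : ℝ → ℝ) (f f₁ : ℝ → ℂ) (x : ℝ) : ℂ :=
  -(deriv (deriv χ) x * f x) - 2 * (deriv χ x * f₁ x)

theorem continuous_commutator {χ : ℝ → ℝ} (hχ : ContDiff ℝ 2 χ) {f f₁ : ℝ → ℂ}
    (hf : Continuous f) (hf₁ : Continuous f₁) : Continuous (commutator χ f f₁) := by
  have hχ₁ : ContDiff ℝ 1 (deriv χ) := (contDiff_succ_iff_deriv (n := 1)).1 hχ |>.2.2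
  exact ((Complex.continuous_ofReal.comp (hχ₁.continuous_deriv le_rfl)).mul hf).neg.sub
    (continuous_const.mul ((Complex.continuous_ofReal.comp hχ₁.continuous).mul hf₁))

theorem IsBlochWave.mul_mem_lineGraph {q : ℝ → ℂ} {w μ : ℂ} {f f₁ : ℝ → ℂ}
    (h : IsBlochWave q w μ f f₁) {χ : ℝ → ℝ} (hχ : ContDiff ℝ 2 χ) {y r : L2Line}
    (hy : y =ᵐ[volume] fun x => χ x * f x) (hr : r =ᵐ[volume] commutator χ f f₁) :
    (y, r + w • y) ∈ lineGraph q := by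
  have hχ₁ : ContDiff ℝ 1 (deriv χ) := (contDiff_succ_iff_deriv (n := 1)).1 hχ |>.2.2
  refine ⟨fun x => χ x * f x, fun x => deriv χ x * f x + χ x * f₁ x,
    fun x => (deriv (deriv χ) x * f x + deriv χ x * f₁ x) +
      (deriv χ x * f₁ x + χ x * ((q x - w) * f x)), fun a b hab => ?_, hy, ?_⟩
  · have hp := isPrimitiveOn_of_contDiff (hχ.of_le one_le_two) a b
    have hp₁ := isPrimitiveOn_of_contDiff hχ₁ a b
    have hf := h.isPrimitiveOn a b hab
    exact (hp.mul hab hf).twiceAC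
      ((hp₁.mul hab hf).add (hp.mul hab (h.isPrimitiveOn_deriv a b hab)))
  · filter_upwards [hy, hr, Lp.coeFn_add r (w • y), Lp.coeFn_smul w y] with x hyx hrx hadd hsmul
    rw [hadd, Pi.add_apply, hsmul, Pi.smul_apply, hyx, hrx, smul_eq_mul, commutator]
    ring

/-- A smooth cut-off function which is supported in `[0, d + 1]` and equal to `1` on `[1, d]`. -/
noncomputable def cutoff (d x : ℝ) : ℝ := Real.smoothTransition x - Real.smoothTransition (x - d)

theorem contDiff_cutoff (d : ℝ) : ContDiff ℝ 2 (cutoff d) :=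
  Real.smoothTransition.contDiff.sub
    (Real.smoothTransition.contDiff.comp (contDiff_id.sub contDiff_const))

theorem cutoff_eq_zero {d x : ℝ} (hd : 0 ≤ d) (hx : x ∉ Icc 0 (d + 1)) : cutoff d x = 0 := by
  rcases lt_or_ge x 0 with h | h
  · rw [cutoff, Real.smoothTransition.zero_of_nonpos h.le,
      Real.smoothTransition.zero_of_nonpos (by linarith), sub_zero]
  · have hxd : d + 1 < x := lt_of_not_ge fun h' => hx ⟨h, h'⟩
    rw [cutoff, Real.smoothTransition.one_of_one_le (by linarith),
      Real.smoothTransition.one_of_one_le (by linarith), sub_self]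

theorem cutoff_eq_one {d x : ℝ} (hx : x ∈ Icc 1 d) : cutoff d x = 1 := by
  rw [cutoff, Real.smoothTransition.one_of_one_le hx.1,
    Real.smoothTransition.zero_of_nonpos (sub_nonpos.2 hx.2), sub_zero]

theorem commutator_smoothTransition_eq_zero (f f₁ : ℝ → ℂ) {x : ℝ} (hx : x ∉ Icc (0 : ℝ) 1) :
    commutator Real.smoothTransition f f₁ x = 0 := by
  obtain ⟨k, hk⟩ : ∃ k : ℝ, Real.smoothTransition =ᶠ[𝓝 x] fun _ => k := by
    rcases lt_or_ge x 0 with h | h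
    · exact ⟨0, (eventually_lt_nhds h).mono fun y hy => Real.smoothTransition.zero_of_nonpos hy.le⟩
    · exact ⟨1, (eventually_gt_nhds (lt_of_not_ge fun h' => hx ⟨h, h'⟩)).mono
        fun y hy => Real.smoothTransition.one_of_one_le hy.le⟩
  have hderiv : deriv Real.smoothTransition =ᶠ[𝓝 x] fun _ => 0 := by simpa using hk.deriv
  have hderiv₂ : deriv (deriv Real.smoothTransition) x = 0 := by simpa using hderiv.deriv_eq
  simp [commutator, hderiv.self_of_nhds, hderiv₂]

theorem deriv_sub_comp_sub_right {g : ℝ → ℝ} (hg : Differentiable ℝ g) (d : ℝ) :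
    deriv (fun x => g x - g (x - d)) = fun x => deriv g x - deriv g (x - d) :=
  funext fun x =>
    ((hg x).hasDerivAt.fun_sub ((hg (x - d)).hasDerivAt.comp_sub_const x d)).deriv

namespace IsBlochWave

variable {q : ℝ → ℂ} {w μ : ℂ} {f f₁ : ℝ → ℂ}

theorem eq_pow_mul {g : ℝ → ℂ} (hg : ∀ x, g (x + 1) = μ * g x) (n : ℕ) (x : ℝ) :
    g x = μ ^ n * g (x - n) := by
  induction n with
  | zero => simp
  | succ n ih =>
    rw [ih, pow_succ, mul_assoc, ← hg]
    congr 2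
    push_cast
    ring

theorem commutator_cutoff (h : IsBlochWave q w μ f f₁) (n : ℕ) (x : ℝ) :
    commutator (cutoff n) f f₁ x = commutator Real.smoothTransition f f₁ x -
      μ ^ n * commutator Real.smoothTransition f f₁ (x - n) := by
  have hS : ContDiff ℝ 2 Real.smoothTransition := Real.smoothTransition.contDiff
  have hS₁ : ContDiff ℝ 1 (deriv Real.smoothTransition) :=
    (contDiff_succ_iff_deriv (n := 1)).1 hS |>.2.2
  have hd : deriv (cutoff n) = _ := deriv_sub_comp_sub_right (hS.differentiable two_ne_zero) n
  have hd₂ := deriv_sub_comp_sub_right (hS₁.differentiable one_ne_zero) n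
  rw [commutator, commutator, commutator, hd, hd₂, eq_pow_mul h.add_one n x,
    eq_pow_mul h.deriv_add_one n x]
  push_cast
  ring

/- Both ends of the cut-off contribute the same function up to a translation and a factor of modulus
one, which is why the bound does not depend on `n`. -/
theorem exists_norm_commutator_le (h : IsBlochWave q w μ f f₁) :
    ∃ C : ℝ, ∀ n : ℕ, ∃ r : L2Line,
      r =ᵐ[volume] commutator (cutoff n) f f₁ ∧ ‖r‖ ≤ C := by
  have hg : MemLp (commutator Real.smoothTransition f f₁) 2 volume :=
    (continuous_commutator Real.smoothTransition.contDiff h.continuous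
      h.continuous_deriv).memLp_of_hasCompactSupport
        (.intro isCompact_Icc fun _ => commutator_smoothTransition_eq_zero f f₁)
  refine ⟨2 * ‖hg.toLp _‖, fun n => ?_⟩
  have hshift := measurePreserving_sub_right (volume : Measure ℝ) (n : ℝ)
  refine ⟨hg.toLp _ - μ ^ n • Lp.compMeasurePreserving _ hshift (hg.toLp _), ?_, ?_⟩
  · filter_upwards [Lp.coeFn_sub (hg.toLp _)
        (μ ^ n • Lp.compMeasurePreserving _ hshift (hg.toLp _)),
      Lp.coeFn_smul (μ ^ n) (Lp.compMeasurePreserving _ hshift (hg.toLp _)),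
      Lp.coeFn_compMeasurePreserving (hg.toLp _) hshift, hg.coeFn_toLp,
      hshift.quasiMeasurePreserving.ae hg.coeFn_toLp] with x hsub hsmul hcomp hx hxn
    rw [hsub, Pi.sub_apply, hsmul, Pi.smul_apply, hcomp, Function.comp_apply, hx, hxn,
      h.commutator_cutoff, smul_eq_mul]
  · refine (norm_sub_le _ _).trans_eq ?_
    rw [norm_smul, norm_pow, h.norm_multiplier, one_pow, one_mul, Lp.norm_compMeasurePreserving,
      two_mul]

theorem mul_integral_le_norm_sq (h : IsBlochWave q w μ f f₁) (n : ℕ) {y : L2Line}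
    (hy : y =ᵐ[volume] fun x => cutoff (n + 1) x * f x) :
    n * ∫ x in (0 : ℝ)..1, ‖f x‖ ^ 2 ≤ ‖y‖ ^ 2 := by
  have hmem : MemLp (fun x => cutoff (n + 1) x * f x) 2 volume := (memLp_congr_ae hy).1 (Lp.memLp y)
  have hy' : y = hmem.toLp _ := Lp.ext (hy.trans hmem.coeFn_toLp.symm)
  rw [hy', norm_sq_toLp, ← h.integral_norm_sq, intervalIntegral.integral_of_le (by simp),
    setIntegral_congr_fun (g := fun x => ‖cutoff (n + 1) x * f x‖ ^ 2) measurableSet_Ioc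
      fun x hx => by simp [cutoff_eq_one ⟨hx.1.le, hx.2.trans_eq (add_comm _ _)⟩]]
  exact setIntegral_le_integral (hmem.integrable_norm_pow two_ne_zero)
    (ae_of_all _ fun _ => by positivity)

theorem mem_spectrum_lineOp (h : IsBlochWave q w μ f f₁)
    (hpos : 0 < ∫ x in (0 : ℝ)..1, ‖f x‖ ^ 2) : w ∈ UnboundedOp.spectrum (lineOp q) := by
  obtain ⟨C, hC⟩ := h.exists_norm_commutator_le
  refine UnboundedOp.mem_spectrum_of_unbounded (C := C) fun B => ?_
  obtain ⟨n, hn⟩ := exists_nat_gt (B ^ 2 / ∫ x in (0 : ℝ)..1, ‖f x‖ ^ 2)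
  rw [div_lt_iff₀ hpos] at hn
  obtain ⟨r, hr, hrC⟩ := hC (n + 1)
  push_cast at hr
  have hχ := contDiff_cutoff (n + 1)
  have hcont : Continuous fun x => cutoff (n + 1) x * f x :=
    (Complex.continuous_ofReal.comp hχ.continuous).mul h.continuous
  have hmem : MemLp (fun x => cutoff (n + 1) x * f x) 2 volume :=
    hcont.memLp_of_hasCompactSupport (.intro isCompact_Icc fun x hx => by
      rw [cutoff_eq_zero (by positivity) hx, Complex.ofReal_zero, zero_mul])
  refine ⟨hmem.toLp _, r, ?_, hrC, lt_of_pow_lt_pow_left₀ 2 (norm_nonneg _)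
    (hn.trans_le (h.mul_integral_le_norm_sq n hmem.coeFn_toLp))⟩
  rw [lineOp_graph]
  exact h.mul_mem_lineGraph hχ hmem.coeFn_toLp hr

end IsBlochWave

theorem exists_mem_Ioo_two_pi {t : ℝ} (ht : Real.sin t ≠ 0) :
    ∃ s ∈ Ioo 0 (2 * Real.pi), Real.cos s = Real.cos t ∧ Real.sin s = Real.sin t := by
  obtain ⟨s, hs, n, hn⟩ : ∃ s ∈ Ico 0 (2 * Real.pi), ∃ n : ℤ, s = t - n * (2 * Real.pi) :=
    ⟨toIcoMod Real.two_pi_pos 0 t, by simpa using toIcoMod_mem_Ico Real.two_pi_pos 0 t,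
      toIcoDiv Real.two_pi_pos 0 t, by rw [toIcoMod, zsmul_eq_mul]⟩
  have hsin : Real.sin s = Real.sin t := by rw [hn, Real.sin_sub_int_mul_two_pi]
  have hs0 : s ≠ 0 := by
    rintro rfl
    exact ht (by rw [← hsin, Real.sin_zero])
  exact ⟨s, ⟨hs.1.lt_of_ne' hs0, hs.2⟩, by rw [hn, Real.cos_sub_int_mul_two_pi], hsin⟩

end Hill

theorem theorem14 (q : ℝ → ℂ) (hper : Function.Periodic q 1)
    (hint : IntervalIntegrable q MeasureTheory.volume 0 1)
    (t₀ : ℝ) (ht₀ : ∀ n : ℤ, t₀ ≠ n * Real.pi) (w : ℂ)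
    (hw : UnboundedOp.IsMultipleEigenvalue (Hill.fibreOp q t₀) w) :
    Hill.IsSpectralSingularity q w ∧ ¬ Hill.IsEssentialSpectralSingularity q w := by
  obtain ⟨hF, hd⟩ := Hill.discriminant_of_isMultipleEigenvalue hint hw
  have hsin : Real.sin t₀ ≠ 0 := fun h => by
    obtain ⟨n, hn⟩ := Real.sin_eq_zero_iff.1 h
    exact ht₀ n hn.symm
  obtain ⟨f, f₁, hf, hpos⟩ := Hill.exists_isBlochWave hint hper hF
  obtain ⟨t, ht, hcos, hsin'⟩ := Hill.exists_mem_Ioo_two_pi hsin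
  exact ⟨⟨hf.mem_spectrum_lineOp hpos, fun ε hε =>
      Hill.not_bounded_projections hint ht (by rw [hF, hcos]) hd (by rwa [hsin']) hε⟩,
    Hill.not_isEssentialSpectralSingularity hint hF hsin⟩
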